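/- **Setting.** Consider the session-typed language polarized SILL, whose processes are given by the judgments $\Psi;\Delta\vdash P::c:C$: the process $P$ provides the session type $C$ on the channel $c$, uses the channels of the linear context $\Delta=a_1:A_1,\dots,a_n:A_n$ (all channel names in $\Delta,c:C$ are distinct), and uses functional variables from the structural context $\Psi$. Among the rules of process formation are $$\frac{}{\Psi;\cdot\vdash \mathsf{close}\ a::a:\mathbf 1}\qquad \frac{\Psi;\Delta\vdash P::c:C}{\Psi;\Delta,a:\mathbf 1\vdash \mathsf{wait}\ a;P::c:C}\qquad \frac{\Psi;\Delta_1\vdash P::a:A\quad \Psi;a:A,\Delta_2\vdash Q::c:C}{\Psi;\Delta_1,\Delta_2\vdash a\leftarrow P;Q::c:C}$$ and the rules for forwarding, polarity shifts ($\downarrow,\uparrow$), internal and external choice ($\oplus,\&$), channel transmission ($\otimes,\multimap$), value transmission ($\wedge,\supset$), recursive types ($\rho\alpha.A$) and quoted processes; functional terms are those of a simply typed call-by-value $\lambda$-calculus with $\mathsf{fix}$ and quoted processes. **Semantics.** Every session type $A$ denotes two pointed directed-complete partial orders, its negative and positive aspects $[\![A]\!]^-$ and $[\![A]\!]^+$ (recursive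 types being interpreted by canonical solutions of domain equations); in particular $[\![\mathbf 1]\!]^-=\{\bot\}$ and $[\![\mathbf 1]\!]^+=\{\ast\}_\bot=\{\bot\sqsubset\ast\}$. Let $[\![\Delta]\!]^{\pm}=\prod_i[\![A_i]\!]^{\pm}$, and let $[\![\Psi]\!]$ be the product of the domains of the types of the functional variables in $\Psi$. A process denotes a continuous function $$[\![\Psi;\Delta\vdash P::c:C]\!]:[\![\Psi]\!]\to\bigl[[\![\Delta]\!]^+\times[\![C]\!]^-\to[\![\Delta]\!]^-\times[\![C]\!]^+\bigr],$$ defined by recursion on $P$, with one clause for each rule. The clauses for the three rules above are as follows, for $u\in[\![\Psi]\!]$. * $[\![\mathsf{close}\ a]\!]u(\bot)=\ast$ (the output on $a^+$). * $[\![\mathsf{wait}\ a;P]\!]u(\delta^+,a^+,c^-)$ is $\bot$ if $a^+=\bot$, and it is $(\delta^-,\bot,c^+)$ if $a^+=\ast$, where $[\![P]\!]u(\delta^+,c^-)=(\delta^-,c^+)$. * $[\![a\leftarrow P;Q]\!]u$ is the trace of $[\![P]\!]u\times[\![Q]\!]u$ over the feedback component $[\![A]\!]^-\times[\![A]\!]^+$.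 That is, $[\![a\leftarrow P;Q]\!]u(\delta_1^+,\delta_2^+,c^-)=(\delta_1^-,\delta_2^-,c^+)$, where $\delta_1^-,\delta_2^-,a^-,a^+,c^+$ is the least solution of the equations $(\delta_1^-,a^+)=[\![P]\!]u(\delta_1^+,a^-)$ and $(\delta_2^-,a^-,c^+)=[\![Q]\!]u(\delta_2^+,a^+,c^-)$. Processes $P$ and $Q$ with $\Psi;\Delta\vdash P::c:C$ and $\Psi;\Delta\vdash Q::c:C$ are equivalent, $P\equiv Q$, if they have the same denotation. **Proposition ($\eta$ for $\mathbf 1$).** For every process $\Psi;\Delta\vdash P::c:C$ and every channel name $a$ that does not occur in $\Delta,c:C$, $$P\;\equiv\;a\leftarrow \mathsf{close}\ a;\,(\mathsf{wait}\ a;P).$$ -/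

import Mathlib

namespace SILL

open Set

/-! ### Pointed directed-complete partial orders -/

section Order

/-- A partial order with a least element in which nonempty directed sets have suprema is a pointed
dcpo. -/
noncomputable abbrev cpoOfExists (α : Type) [PartialOrder α] [OrderBot α]
    (h : ∀ d : Set α, d.Nonempty → DirectedOn (· ≤ ·) d → ∃ x, IsLUB d x) :
    CompletePartialOrder α :=
  { (inferInstance : PartialOrder α), (inferInstance : OrderBot α) with
    sSup := fun d => @Classical.epsilon α ⟨⊥⟩ (IsLUB d)
    lubOfDirected := fun d hd => by
      have key : ∃ x, IsLUB d x := by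
        rcases d.eq_empty_or_nonempty with rfl | hne
        · exact ⟨⊥, isLUB_empty⟩
        · exact h d hne hd
      exact Classical.epsilon_spec key }

/-- Nonempty directed subsets have suprema. -/
def DirComplete (α : Type) [PartialOrder α] : Prop :=
  ∀ d : Set α, d.Nonempty → DirectedOn (· ≤ ·) d → ∃ x, IsLUB d x

theorem dirComplete (α : Type) [CompletePartialOrder α] : DirComplete α :=
  fun _ _ hd => ⟨_, hd.isLUB_sSup⟩

theorem directedOn_image {α β : Type} [Preorder α] [Preorder β] {f : α → β} (hf : Monotone f)
    {d : Set α} (hd : DirectedOn (· ≤ ·) d) : DirectedOn (· ≤ ·) (f '' d) := by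
  rintro _ ⟨a, ha, rfl⟩ _ ⟨b, hb, rfl⟩
  obtain ⟨c, hc, hac, hbc⟩ := hd a ha b hb
  exact ⟨f c, ⟨c, hc, rfl⟩, hf hac, hf hbc⟩

noncomputable instance instCPOProd {α β : Type} [CompletePartialOrder α] [CompletePartialOrder β] :
    CompletePartialOrder (α × β) :=
  cpoOfExists (α × β) fun d _ hd =>
    ⟨(sSup (Prod.fst '' d), sSup (Prod.snd '' d)), isLUB_prod.2
      ⟨(directedOn_image monotone_fst hd).isLUB_sSup,
        (directedOn_image monotone_snd hd).isLUB_sSup⟩⟩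

noncomputable instance instCPOPi {ι : Type} {α : ι → Type} [∀ i, CompletePartialOrder (α i)] :
    CompletePartialOrder (∀ i, α i) :=
  cpoOfExists (∀ i, α i) fun d _ hd =>
    ⟨fun i => sSup (Function.eval i '' d), isLUB_pi.2 fun i =>
      (directedOn_image (Function.monotone_eval i) hd).isLUB_sSup⟩

theorem isLUB_coe_withBot {α : Type} [PartialOrder α] {d : Set (WithBot α)} {x : α}
    (hne : ∃ a : α, (a : WithBot α) ∈ d) (hx : IsLUB {a : α | (a : WithBot α) ∈ d} x) :
    IsLUB d (x : WithBot α) := by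
  refine ⟨fun w hw => ?_, fun y hy => ?_⟩
  · induction w with
    | bot => exact bot_le
    | coe a => exact WithBot.coe_le_coe.2 (hx.1 hw)
  · obtain ⟨a, ha⟩ := hne
    induction y with
    | bot => exact absurd (hy ha) (WithBot.not_coe_le_bot a)
    | coe y => exact WithBot.coe_le_coe.2 (hx.2 fun b hb => WithBot.coe_le_coe.1 (hy hb))

theorem directedOn_coe_preimage {α : Type} [PartialOrder α] {d : Set (WithBot α)}
    (hd : DirectedOn (· ≤ ·) d) : DirectedOn (· ≤ ·) {a : α | (a : WithBot α) ∈ d} := by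
  intro a ha b hb
  obtain ⟨c, hc, hac, hbc⟩ := hd _ ha _ hb
  induction c with
  | bot => exact absurd hac (WithBot.not_coe_le_bot a)
  | coe c => exact ⟨c, hc, WithBot.coe_le_coe.1 hac, WithBot.coe_le_coe.1 hbc⟩

/-- The lift `α_⊥` of a (not necessarily pointed) dcpo `α` is a pointed dcpo. -/
noncomputable abbrev cpoWithBot {α : Type} [PartialOrder α] (h : DirComplete α) :
    CompletePartialOrder (WithBot α) :=
  cpoOfExists (WithBot α) fun d _ hd => by
    by_cases hne : ∃ a : α, (a : WithBot α) ∈ d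
    · obtain ⟨x, hx⟩ := h _ hne (directedOn_coe_preimage hd)
      exact ⟨x, isLUB_coe_withBot hne hx⟩
    · refine ⟨⊥, fun w hw => ?_, fun y _ => bot_le⟩
      induction w with
      | bot => exact le_rfl
      | coe a => exact absurd ⟨a, hw⟩ hne

noncomputable instance instCPOWithBot {α : Type} [CompletePartialOrder α] :
    CompletePartialOrder (WithBot α) := cpoWithBot (dirComplete α)

theorem sigma_fiber {ι : Type} {α : ι → Type} [∀ i, PartialOrder (α i)] {d : Set (Σ i, α i)}
    (hd : DirectedOn (· ≤ ·) d) {i j : ι} {a : α i} {b : α j} (ha : (⟨i, a⟩ : Σ i, α i) ∈ d)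
    (hb : (⟨j, b⟩ : Σ i, α i) ∈ d) : i = j := by
  obtain ⟨c, _, hac, hbc⟩ := hd _ ha _ hb
  exact (Sigma.le_def.1 hac).1.trans (Sigma.le_def.1 hbc).1.symm

theorem sigma_eq_image {ι : Type} {α : ι → Type} [∀ i, PartialOrder (α i)] {d : Set (Σ i, α i)}
    (hd : DirectedOn (· ≤ ·) d) {i : ι} {a : α i} (ha : (⟨i, a⟩ : Σ i, α i) ∈ d) :
    d = Sigma.mk i '' {b | (⟨i, b⟩ : Σ i, α i) ∈ d} := by
  ext ⟨j, b⟩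
  constructor
  · intro hb
    obtain rfl := sigma_fiber hd ha hb
    exact ⟨b, hb, rfl⟩
  · rintro ⟨b', hb', h⟩
    exact h ▸ hb'

theorem sigma_directedOn {ι : Type} {α : ι → Type} [∀ i, PartialOrder (α i)] {d : Set (Σ i, α i)}
    (hd : DirectedOn (· ≤ ·) d) (i : ι) :
    DirectedOn (· ≤ ·) {b : α i | (⟨i, b⟩ : Σ i, α i) ∈ d} := by
  intro a ha b hb
  obtain ⟨⟨j, c⟩, hc, hac, hbc⟩ := hd _ ha _ hb
  obtain rfl : i = j := (Sigma.le_def.1 hac).1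
  exact ⟨c, hc, Sigma.mk_le_mk_iff.1 hac, Sigma.mk_le_mk_iff.1 hbc⟩

theorem sigma_isLUB {ι : Type} {α : ι → Type} [∀ i, PartialOrder (α i)] {i : ι} {s : Set (α i)}
    {x : α i} (hne : s.Nonempty) (hx : IsLUB s x) :
    IsLUB (Sigma.mk i '' s) (⟨i, x⟩ : Σ i, α i) := by
  refine ⟨?_, ?_⟩
  · rintro _ ⟨b, hb, rfl⟩
    exact Sigma.mk_le_mk_iff.2 (hx.1 hb)
  · rintro ⟨j, y⟩ hy
    obtain ⟨a, ha⟩ := hne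
    obtain rfl : i = j := (Sigma.le_def.1 (hy ⟨a, ha, rfl⟩)).1
    exact Sigma.mk_le_mk_iff.2 (hx.2 fun b hb => Sigma.mk_le_mk_iff.1 (hy ⟨b, hb, rfl⟩))

theorem dirComplete_sigma {ι : Type} {α : ι → Type} [∀ i, CompletePartialOrder (α i)] :
    DirComplete (Σ i, α i) := by
  rintro d ⟨⟨i, a⟩, ha⟩ hd
  refine ⟨⟨i, sSup {b | (⟨i, b⟩ : Σ i, α i) ∈ d}⟩, ?_⟩
  have := sigma_isLUB (α := α) ⟨a, ha⟩ (sigma_directedOn hd i).isLUB_sSup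
  rwa [← sigma_eq_image hd ha] at this

/-- The lifted disjoint union of a family of pointed dcpos. Its elements are `⊥` and the labelled
elements `(i, a)`; it is (isomorphic to) the coalesced sum of the lifts of the `α i`. -/
noncomputable instance instCPOSum {ι : Type} {α : ι → Type} [∀ i, CompletePartialOrder (α i)] :
    CompletePartialOrder (WithBot (Σ i, α i)) := cpoWithBot dirComplete_sigma

noncomputable instance instCPOUnit : CompletePartialOrder PUnit.{1} :=
  cpoOfExists PUnit.{1} fun _ _ _ => ⟨⊥, fun _ _ => le_rfl, fun _ _ => le_rfl⟩

/-! ### Scott continuous functions -/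

theorem scott_pi {α : Type} [Preorder α] {ι : Type} {β : ι → Type} [∀ i, Preorder (β i)]
    {f : α → ∀ i, β i} (h : ∀ i, ScottContinuous fun a => f a i) : ScottContinuous f := by
  intro d hne hd a ha
  refine isLUB_pi.2 fun i => ?_
  rw [← image_comp]
  exact h i hne hd ha

theorem scott_eval {ι : Type} {β : ι → Type} [∀ i, Preorder (β i)] (i : ι) :
    ScottContinuous fun a : ∀ i, β i => a i := by
  intro d _ _ a ha
  exact isLUB_pi.1 ha i

theorem scott_coe {α : Type} [PartialOrder α] : ScottContinuous fun a : α => (a : WithBot α) := by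
  intro d hne _ a ha
  obtain ⟨x, hx⟩ := hne
  refine isLUB_coe_withBot ⟨x, x, hx, rfl⟩ ?_
  have : {b : α | (b : WithBot α) ∈ (fun a : α => (a : WithBot α)) '' d} = d := by
    ext b
    simp
  rwa [this]

theorem scott_sigmaMk {ι : Type} {α : ι → Type} [∀ i, PartialOrder (α i)] (i : ι) :
    ScottContinuous fun a : α i => (⟨i, a⟩ : Σ i, α i) :=
  fun _ hne _ _ ha => sigma_isLUB hne ha

/-- Continuity of the strict extension of a function to a lift. -/
theorem scott_withBot {α β : Type} [PartialOrder α] [PartialOrder β] [OrderBot β]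
    {f : WithBot α → β} (h0 : f ⊥ = ⊥) (h : ScottContinuous fun a : α => f a) :
    ScottContinuous f := by
  have hmono : Monotone f := by
    intro v w hvw
    induction v with
    | bot => rw [h0]; exact bot_le
    | coe a =>
      induction w with
      | bot => exact absurd hvw (WithBot.not_coe_le_bot a)
      | coe b => exact h.monotone (WithBot.coe_le_coe.1 hvw)
  intro d hne hd w hw
  refine ⟨hmono.mem_upperBounds_image hw.1, fun y hy => ?_⟩
  induction w with
  | bot => rw [h0]; exact bot_le
  | coe x =>
    have hex : ∃ a : α, (a : WithBot α) ∈ d := by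
      by_contra hcon
      refine WithBot.not_coe_le_bot x (hw.2 fun v hv => ?_)
      induction v with
      | bot => exact le_rfl
      | coe a => exact absurd ⟨a, hv⟩ hcon
    have hx : IsLUB {a : α | (a : WithBot α) ∈ d} x := by
      refine ⟨fun a ha => WithBot.coe_le_coe.1 (hw.1 ha), fun z hz => ?_⟩
      refine WithBot.coe_le_coe.1 (hw.2 fun v hv => ?_)
      induction v with
      | bot => exact bot_le
      | coe a => exact WithBot.coe_le_coe.2 (hz hv)
    refine (h hex (directedOn_coe_preimage hd) hx).2 ?_
    rintro _ ⟨a, ha, rfl⟩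
    exact hy ⟨_, ha, rfl⟩

theorem scott_sigma {ι : Type} {α : ι → Type} {β : Type} [∀ i, PartialOrder (α i)] [PartialOrder β]
    {f : (Σ i, α i) → β} (h : ∀ i, ScottContinuous fun a : α i => f ⟨i, a⟩) :
    ScottContinuous f := by
  rintro d ⟨⟨i, a⟩, ha⟩ hd ⟨j, x⟩ hx
  obtain rfl : i = j := (Sigma.le_def.1 (hx.1 ha)).1
  have hs := sigma_eq_image hd ha
  have hx' : IsLUB {b : α i | (⟨i, b⟩ : Σ i, α i) ∈ d} x := by
    refine ⟨fun b hb => Sigma.mk_le_mk_iff.1 (hx.1 hb), fun z hz => ?_⟩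
    have hub : (⟨i, z⟩ : Σ i, α i) ∈ upperBounds d := by
      rintro ⟨k, b⟩ hb
      obtain rfl := sigma_fiber hd ha hb
      exact Sigma.mk_le_mk_iff.2 (hz hb)
    exact Sigma.mk_le_mk_iff.1 (hx.2 hub)
  have := h i ⟨a, ha⟩ (sigma_directedOn hd i) hx'
  rw [hs, ← image_comp]
  exact this

open Classical in
/-- `y`, made strict in `w`. -/
noncomputable def strictOn {β γ : Type} [PartialOrder β] [OrderBot β] [PartialOrder γ]
    [OrderBot γ] (w : β) (y : γ) : γ :=
  if w = ⊥ then ⊥ else y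

theorem strictOn_of_eq {β γ : Type} [PartialOrder β] [OrderBot β] [PartialOrder γ]
    [OrderBot γ] {w : β} {y : γ} (h : w = ⊥) : strictOn w y = ⊥ := if_pos h

theorem strictOn_of_ne {β γ : Type} [PartialOrder β] [OrderBot β] [PartialOrder γ]
    [OrderBot γ] {w : β} {y : γ} (h : w ≠ ⊥) : strictOn w y = y := if_neg h

theorem scott_strictOn {α β γ : Type} [Preorder α] [PartialOrder β] [OrderBot β] [PartialOrder γ]
    [OrderBot γ] {t : α → β} {f : α → γ} (ht : ScottContinuous t) (hf : ScottContinuous f) :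
    ScottContinuous fun x => strictOn (t x) (f x) := by
  have hmono : Monotone fun x => strictOn (t x) (f x) := fun a b hab => by
    by_cases ha : t a = ⊥
    · exact (strictOn_of_eq (y := f a) ha).le.trans bot_le
    · have hb : t b ≠ ⊥ := fun hb => ha (le_bot_iff.1 (hb ▸ ht.monotone hab))
      show strictOn (t a) (f a) ≤ strictOn (t b) (f b)
      rw [strictOn_of_ne ha, strictOn_of_ne hb]
      exact hf.monotone hab
  intro d hne hd a ha
  refine ⟨hmono.mem_upperBounds_image ha.1, fun y hy => ?_⟩
  by_cases ha0 : t a = ⊥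
  · exact (strictOn_of_eq (y := f a) ha0).le.trans bot_le
  · obtain ⟨x, hx, hx0⟩ : ∃ x ∈ d, t x ≠ ⊥ := by
      by_contra! hcon
      refine ha0 (le_bot_iff.1 ((ht hne hd ha).2 ?_))
      rintro _ ⟨x, hx, rfl⟩
      exact (hcon x hx).le
    refine (strictOn_of_ne (y := f a) ha0).le.trans ((hf hne hd ha).2 ?_)
    rintro _ ⟨z, hz, rfl⟩
    obtain ⟨w, hw, hxw, hzw⟩ := hd x hx z hz
    have hw0 : t w ≠ ⊥ := fun h' => hx0 (le_bot_iff.1 (h' ▸ ht.monotone hxw))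
    refine (hf.monotone hzw).trans (le_trans (le_of_eq ?_) (hy ⟨w, hw, rfl⟩))
    exact (strictOn_of_ne hw0).symm

/-- The strict function of `w` that is given by `f a` at `w = ↑a`. -/
def onUp {α β : Type} [LE β] [OrderBot β] (w : WithBot α) (f : α → β) : β :=
  WithBot.recBotCoe ⊥ f w

theorem scott_onUp {α β γ : Type} [Preorder γ] [PartialOrder α] [PartialOrder β] [OrderBot β]
    {t : γ → WithBot α} {f : γ → α → β} (ht : ScottContinuous t)
    (hf : ScottContinuous fun p : γ × α => f p.1 p.2) :
    ScottContinuous fun x => onUp (t x) (f x) := by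
  have h : ScottContinuous fun p : γ × WithBot α => onUp p.2 (f p.1) := by
    refine ScottContinuous.fromProd (fun x => ?_) (fun w => ?_)
    · refine scott_withBot rfl ?_
      exact ((ScottContinuous.fun_const x).prodMk ScottContinuous.fun_id).comp hf
    · cases w with
      | bot => exact ScottContinuous.fun_const _
      | coe a => exact (ScottContinuous.fun_id.prodMk (ScottContinuous.fun_const a)).comp hf
  exact (ScottContinuous.fun_id.prodMk ht).comp h

/-- The counit `down`. -/
def down {α : Type} [LE α] [OrderBot α] (w : WithBot α) : α := onUp w fun a => a

theorem scott_down {α : Type} [PartialOrder α] [OrderBot α] :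
    ScottContinuous fun w : WithBot α => down w :=
  scott_withBot rfl ScottContinuous.fun_id

theorem scott_update {ι : Type} [DecidableEq ι] {β : ι → Type} [∀ i, PartialOrder (β i)]
    [∀ i, OrderBot (β i)] (i : ι) :
    ScottContinuous fun b : β i => Function.update (⊥ : ∀ i, β i) i b := by
  refine scott_pi fun k => ?_
  by_cases h : k = i
  · subst h
    simp only [Function.update_self]
    exact ScottContinuous.fun_id
  · simp only [Function.update_of_ne h]
    exact ScottContinuous.fun_const _

end Order

/-! ### The category of pointed dcpos -/

/-- A domain: a pointed directed-complete partial order. -/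
structure Dom where
  carrier : Type
  [str : CompletePartialOrder carrier]

instance : CoeSort Dom Type := ⟨Dom.carrier⟩

attribute [instance] Dom.str

/-- Continuous functions. -/
structure Hom (D E : Dom) where
  toFun : D → E
  cont : ScottContinuous toFun

namespace Hom

variable {D E F G : Dom}

instance : FunLike (Hom D E) D E where
  coe := toFun
  coe_injective f g h := by cases f; cases g; congr

@[ext] theorem ext {f g : Hom D E} (h : ∀ x, f x = g x) : f = g := DFunLike.ext f g h

/-- Continuous functions are ordered pointwise. -/
instance : PartialOrder (Hom D E) := PartialOrder.lift (fun f => (f : D → E)) DFunLike.coe_injective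

instance : OrderBot (Hom D E) where
  bot := ⟨fun _ => ⊥, ScottContinuous.fun_const ⊥⟩
  bot_le _ _ := bot_le

theorem le_def {f g : Hom D E} : f ≤ g ↔ ∀ x, f x ≤ g x := Iff.rfl

theorem mono (f : Hom D E) : Monotone f := f.cont.monotone

theorem directedOn_eval {S : Set (Hom D E)} (hS : DirectedOn (· ≤ ·) S) (x : D) :
    DirectedOn (· ≤ ·) ((fun f : Hom D E => f x) '' S) :=
  directedOn_image (f := fun f : Hom D E => f x) (fun _ _ h => le_def.1 h x) hS

/-- The pointwise supremum of a directed set of continuous functions. -/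
noncomputable def sup (S : Set (Hom D E)) (hS : DirectedOn (· ≤ ·) S) : Hom D E where
  toFun x := sSup ((fun f : Hom D E => f x) '' S)
  cont := by
    have hl := fun x => (directedOn_eval hS x).isLUB_sSup
    intro d hne hd a ha
    constructor
    · rintro _ ⟨x, hx, rfl⟩
      refine (hl x).2 ?_
      rintro _ ⟨f, hf, rfl⟩
      exact (f.mono (ha.1 hx)).trans ((hl a).1 ⟨f, hf, rfl⟩)
    · intro y hy
      refine (hl a).2 ?_
      rintro _ ⟨f, hf, rfl⟩
      refine (f.cont hne hd ha).2 ?_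
      rintro _ ⟨x, hx, rfl⟩
      exact ((hl x).1 ⟨f, hf, rfl⟩).trans (hy ⟨x, hx, rfl⟩)

theorem isLUB_sup (S : Set (Hom D E)) (hS : DirectedOn (· ≤ ·) S) : IsLUB S (sup S hS) :=
  ⟨fun f hf x => (directedOn_eval hS x).isLUB_sSup.1 ⟨f, hf, rfl⟩,
    fun g hg x => (directedOn_eval hS x).isLUB_sSup.2 (by
      rintro _ ⟨f, hf, rfl⟩
      exact hg hf x)⟩

noncomputable instance : CompletePartialOrder (Hom D E) :=
  cpoOfExists (Hom D E) fun S _ hS => ⟨sup S hS, isLUB_sup S hS⟩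

theorem isLUB_iff {S : Set (Hom D E)} (hS : DirectedOn (· ≤ ·) S) {g : Hom D E} :
    IsLUB S g ↔ ∀ x, IsLUB ((fun f : Hom D E => f x) '' S) (g x) := by
  constructor
  · intro h x
    rw [h.unique (isLUB_sup S hS)]
    exact (directedOn_eval hS x).isLUB_sSup
  · intro h
    exact ⟨fun f hf x => (h x).1 ⟨f, hf, rfl⟩, fun k hk x => (h x).2 (by
      rintro _ ⟨f, hf, rfl⟩
      exact hk hf x)⟩

/-- Application is continuous in the function and the argument jointly. -/
theorem scott_app : ScottContinuous fun p : Hom D E × D => p.1 p.2 :=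
  ScottContinuous.fromProd (fun f => f.cont) (fun x _ _ hS _ hg => (isLUB_iff hS).1 hg x)

@[fun_prop]
theorem scott (f : Hom D E) : ScottContinuous fun x => f x := f.cont

@[fun_prop]
theorem scott_app' {α : Type} [Preorder α] {f : α → Hom D E} {g : α → D}
    (hf : ScottContinuous f) (hg : ScottContinuous g) : ScottContinuous fun a => f a (g a) :=
  (hf.prodMk hg).comp scott_app

theorem scott_hom {α : Type} [Preorder α] {f : α → Hom D E}
    (h : ∀ x, ScottContinuous fun a => f a x) : ScottContinuous f := by
  intro d hne hd a ha
  have hm : Monotone f := fun a b hab x => (h x).monotone hab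
  refine (isLUB_iff (directedOn_image hm hd)).2 fun x => ?_
  rw [← image_comp]
  exact h x hne hd ha

protected def id (D : Dom) : Hom D D := ⟨fun x => x, ScottContinuous.fun_id⟩

def comp (g : Hom E F) (f : Hom D E) : Hom D F := ⟨fun x => g (f x), f.cont.comp g.cont⟩

end Hom

namespace Dom

/-- The one-point domain. -/
@[reducible] noncomputable def unit : Dom := ⟨PUnit⟩

/-- Binary products. -/
@[reducible] noncomputable def prod (D E : Dom) : Dom := ⟨D × E⟩

/-- Indexed products. -/
@[reducible] noncomputable def pi {ι : Type} (D : ι → Dom) : Dom := ⟨∀ i, D i⟩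

/-- The lift `D_⊥`. -/
@[reducible] noncomputable def lift (D : Dom) : Dom := ⟨WithBot D⟩

/-- The lifted disjoint union, that is, the coalesced sum of the lifts of the `D i`. -/
@[reducible] noncomputable def sum {ι : Type} (D : ι → Dom) : Dom := ⟨WithBot (Σ i, D i)⟩

/-- The domain of continuous functions. -/
@[reducible] noncomputable def fn (D E : Dom) : Dom := ⟨Hom D E⟩

end Dom

/-- Strict continuous functions. -/
structure SHom (D E : Dom) extends Hom D E where
  strict : toFun ⊥ = ⊥

namespace SHom

variable {D E F : Dom}

instance : FunLike (SHom D E) D E where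
  coe f := f.toFun
  coe_injective f g h := by
    rcases f with ⟨⟨f, _⟩, _⟩
    rcases g with ⟨⟨g, _⟩, _⟩
    congr

@[ext] theorem ext {f g : SHom D E} (h : ∀ x, f x = g x) : f = g := DFunLike.ext f g h

instance : PartialOrder (SHom D E) :=
  PartialOrder.lift (fun f => (f : D → E)) DFunLike.coe_injective

instance : OrderBot (SHom D E) where
  bot := ⟨⊥, rfl⟩
  bot_le _ _ := bot_le

theorem map_bot (f : SHom D E) : f ⊥ = ⊥ := f.strict

theorem scott (f : SHom D E) : ScottContinuous f := f.cont

theorem mono (f : SHom D E) : Monotone f := f.cont.monotone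

theorem directedOn_toHom {S : Set (SHom D E)} (hS : DirectedOn (· ≤ ·) S) :
    DirectedOn (· ≤ ·) (toHom '' S) :=
  directedOn_image (f := toHom) (fun _ _ h => h) hS

/-- The pointwise supremum of a directed set of strict continuous functions. -/
noncomputable def sup (S : Set (SHom D E)) (hS : DirectedOn (· ≤ ·) S) : SHom D E where
  toHom := Hom.sup (toHom '' S) (directedOn_toHom hS)
  strict := by
    refine le_bot_iff.1 ((Hom.directedOn_eval (directedOn_toHom hS) ⊥).isLUB_sSup.2 ?_)
    rintro _ ⟨_, ⟨f, _, rfl⟩, rfl⟩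
    exact f.strict.le

theorem isLUB_sup (S : Set (SHom D E)) (hS : DirectedOn (· ≤ ·) S) : IsLUB S (sup S hS) :=
  ⟨fun f hf => (Hom.isLUB_sup _ (directedOn_toHom hS)).1 ⟨f, hf, rfl⟩,
    fun g hg => (Hom.isLUB_sup _ (directedOn_toHom hS)).2 (by
      rintro _ ⟨f, hf, rfl⟩
      exact hg hf)⟩

noncomputable instance : CompletePartialOrder (SHom D E) :=
  cpoOfExists (SHom D E) fun S _ hS => ⟨sup S hS, isLUB_sup S hS⟩

theorem isLUB_iff {S : Set (SHom D E)} (hS : DirectedOn (· ≤ ·) S) {g : SHom D E} :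
    IsLUB S g ↔ ∀ x, IsLUB ((fun f : SHom D E => f x) '' S) (g x) := by
  constructor
  · intro h x
    rw [h.unique (isLUB_sup S hS)]
    have := (Hom.isLUB_iff (directedOn_toHom hS)).1 (Hom.isLUB_sup _ (directedOn_toHom hS)) x
    rw [← image_comp] at this
    exact this
  · intro h
    exact ⟨fun f hf x => (h x).1 ⟨f, hf, rfl⟩, fun k hk x => (h x).2 (by
      rintro _ ⟨f, hf, rfl⟩
      exact hk hf x)⟩

theorem scott_app : ScottContinuous fun p : SHom D E × D => p.1 p.2 :=
  ScottContinuous.fromProd (fun f => f.cont) (fun x _ _ hS _ hg => (isLUB_iff hS).1 hg x)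

@[fun_prop]
theorem scott_app' {α : Type} [Preorder α] {f : α → SHom D E} {g : α → D}
    (hf : ScottContinuous f) (hg : ScottContinuous g) : ScottContinuous fun a => f a (g a) :=
  (hf.prodMk hg).comp scott_app

theorem scott_hom {α : Type} [Preorder α] {f : α → SHom D E}
    (h : ∀ x, ScottContinuous fun a => f a x) : ScottContinuous f := by
  intro d hne hd a ha
  have hm : Monotone f := fun a b hab x => (h x).monotone hab
  refine (isLUB_iff (directedOn_image hm hd)).2 fun x => ?_
  rw [← image_comp]
  exact h x hne hd ha

protected def id (D : Dom) : SHom D D := ⟨Hom.id D, rfl⟩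

def comp (g : SHom E F) (f : SHom D E) : SHom D F :=
  ⟨g.toHom.comp f.toHom, (congrArg g.toFun f.strict).trans g.strict⟩

end SHom

/-- The domain of strict continuous functions. -/
@[reducible] noncomputable def Dom.sfn (D E : Dom) : Dom := ⟨SHom D E⟩

/-! ### Locally continuous functors -/

/-- A locally continuous functor from the `I`-fold power of the category of domains and strict
continuous functions to this category. -/
structure LCF (I : Type) where
  obj : (I → Dom) → Dom
  map : ∀ {X Y : I → Dom}, (∀ i, SHom (X i) (Y i)) → SHom (obj X) (obj Y)
  map_id : ∀ X : I → Dom, map (fun i => SHom.id (X i)) = SHom.id (obj X)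
  map_comp : ∀ {X Y Z : I → Dom} (g : ∀ i, SHom (Y i) (Z i)) (f : ∀ i, SHom (X i) (Y i)),
    map (fun i => (g i).comp (f i)) = (map g).comp (map f)
  map_cont : ∀ X Y : I → Dom, ScottContinuous fun f : ∀ i, SHom (X i) (Y i) => map f

namespace LCF

variable {I J K : Type}

theorem hext {F G : LCF I} (ho : F.obj = G.obj)
    (hm : ∀ (X Y : I → Dom) (f : ∀ i, SHom (X i) (Y i)), HEq (F.map f) (G.map f)) : F = G := by
  rcases F with ⟨Fo, Fm, _, _, _⟩
  rcases G with ⟨Go, Gm, _, _, _⟩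
  obtain rfl : Fo = Go := ho
  have : @Fm = @Gm := by
    funext X Y f
    exact eq_of_heq (hm X Y f)
  subst this
  rfl

/-- Projections. -/
noncomputable def proj (i : I) : LCF I where
  obj X := X i
  map f := f i
  map_id _ := rfl
  map_comp _ _ := rfl
  map_cont _ _ := scott_eval i

/-- Constant functors. -/
noncomputable def const (I : Type) (D : Dom) : LCF I where
  obj _ := D
  map _ := SHom.id D
  map_id _ := rfl
  map_comp _ _ := rfl
  map_cont _ _ := ScottContinuous.fun_const _

/-- Composition. -/
noncomputable def comp (F : LCF I) (H : I → LCF J) : LCF J where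
  obj X := F.obj fun i => (H i).obj X
  map f := F.map fun i => (H i).map f
  map_id X := by
    simp only [map_id]
  map_comp g f := by
    simp only [map_comp]
  map_cont X Y := (scott_pi fun i => (H i).map_cont X Y).comp (F.map_cont _ _)

theorem comp_comp (F : LCF I) (H : I → LCF J) (G : J → LCF K) :
    (F.comp H).comp G = F.comp fun i => (H i).comp G := rfl

/-- Binary products of functors. -/
noncomputable def prod (F G : LCF I) : LCF I where
  obj X := Dom.prod (F.obj X) (G.obj X)
  map f :=
    { toFun := fun x => (F.map f x.1, G.map f x.2)
      cont := by
        have h1 := (F.map f).scott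
        have h2 := (G.map f).scott
        fun_prop
      strict := Prod.ext (F.map f).map_bot (G.map f).map_bot }
  map_id X := by
    refine SHom.ext fun x => ?_
    simp only [map_id]
    rfl
  map_comp g f := by
    refine SHom.ext fun x => ?_
    simp only [map_comp]
    rfl
  map_cont X Y := by
    refine SHom.scott_hom fun x => ScottContinuous.prodMk (f := fun h => F.map h x.1) ?_ ?_
    · exact SHom.scott_app' (F.map_cont X Y) (ScottContinuous.fun_const _)
    · exact SHom.scott_app' (G.map_cont X Y) (ScottContinuous.fun_const _)

/-- Indexed products of functors. -/
noncomputable def pi {L : Type} (F : L → LCF I) : LCF I where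
  obj X := Dom.pi fun l => (F l).obj X
  map f :=
    { toFun := fun x l => (F l).map f (x l)
      cont := scott_pi fun l => (scott_eval l).comp ((F l).map f).scott
      strict := funext fun l => ((F l).map f).map_bot }
  map_id X := by
    refine SHom.ext fun x => ?_
    simp only [map_id]
    rfl
  map_comp g f := by
    refine SHom.ext fun x => ?_
    simp only [map_comp]
    rfl
  map_cont X Y := by
    refine SHom.scott_hom fun x => scott_pi fun l => ?_
    exact SHom.scott_app' ((F l).map_cont X Y) (ScottContinuous.fun_const _)

/-- The lift of a functor. -/
noncomputable def lift (F : LCF I) : LCF I where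
  obj X := Dom.lift (F.obj X)
  map f :=
    { toFun := WithBot.map (F.map f)
      cont := scott_withBot rfl ((F.map f).scott.comp scott_coe)
      strict := rfl }
  map_id X := by
    refine SHom.ext fun x => ?_
    simp only [map_id]
    exact congrFun WithBot.map_id x
  map_comp g f := by
    refine SHom.ext fun x => ?_
    simp only [map_comp]
    cases x <;> rfl
  map_cont X Y := by
    refine SHom.scott_hom fun x => ?_
    cases x with
    | none => exact ScottContinuous.fun_const _
    | some x =>
      exact (SHom.scott_app' (F.map_cont X Y) (ScottContinuous.fun_const x)).comp scott_coe

/-- The lifted disjoint union of functors. -/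
noncomputable def sum {L : Type} (F : L → LCF I) : LCF I where
  obj X := Dom.sum fun l => (F l).obj X
  map f :=
    { toFun := WithBot.map fun p => ⟨p.1, (F p.1).map f p.2⟩
      cont := scott_withBot rfl
        (scott_sigma fun l => (((F l).map f).scott.comp (scott_sigmaMk (α := fun l => (F l).obj _) l)).comp scott_coe)
      strict := rfl }
  map_id X := by
    refine SHom.ext fun x => ?_
    simp only [map_id]
    exact congrFun WithBot.map_id x
  map_comp g f := by
    refine SHom.ext fun x => ?_
    simp only [map_comp]
    cases x <;> rfl
  map_cont X Y := by
    refine SHom.scott_hom fun x => ?_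
    cases x with
    | none => exact ScottContinuous.fun_const _
    | some x =>
      exact ((SHom.scott_app' ((F x.1).map_cont X Y) (ScottContinuous.fun_const x.2)).comp
        (scott_sigmaMk (α := fun l => (F l).obj _) x.1)).comp scott_coe

end LCF

/-! ### Canonical fixed points of locally continuous functors -/

namespace LCF

variable {I J K : Type}

/-- The environment morphism that acts as `f` on the parameters and as `g` on the recursion
variables. -/
def envMap {X Y : I → Dom} {D E : J → Dom} (f : ∀ i, SHom (X i) (Y i)) (g : ∀ j, SHom (D j) (E j)) :
    ∀ s : I ⊕ J, SHom (Sum.elim X D s) (Sum.elim Y E s)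
  | .inl i => f i
  | .inr j => g j

theorem envMap_id (X : I → Dom) (D : J → Dom) :
    envMap (fun i => SHom.id (X i)) (fun j => SHom.id (D j)) =
      fun s => SHom.id (Sum.elim X D s) := by
  funext s
  cases s <;> rfl

theorem envMap_comp {X Y Z : I → Dom} {D E G : J → Dom}
    (f' : ∀ i, SHom (Y i) (Z i)) (g' : ∀ j, SHom (E j) (G j))
    (f : ∀ i, SHom (X i) (Y i)) (g : ∀ j, SHom (D j) (E j)) :
    envMap (fun i => (f' i).comp (f i)) (fun j => (g' j).comp (g j)) =
      fun s => (envMap f' g' s).comp (envMap f g s) := by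
  funext s
  cases s <;> rfl

theorem envMap_scott {α : Type} [CompletePartialOrder α] {X Y : I → Dom} {D E : J → Dom}
    {f : α → ∀ i, SHom (X i) (Y i)} {g : α → ∀ j, SHom (D j) (E j)}
    (hf : ScottContinuous f) (hg : ScottContinuous g) :
    ScottContinuous fun a => envMap (f a) (g a) := by
  refine scott_pi fun s => ?_
  cases s with
  | inl i => exact hf.comp (scott_eval i)
  | inr j => exact hg.comp (scott_eval j)

/-- The action of `F` on a morphism of parameters and a morphism of recursion variables. -/
noncomputable def act (F : J → LCF (I ⊕ J)) {X Y : I → Dom} {D E : J → Dom}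
    (f : ∀ i, SHom (X i) (Y i)) (g : ∀ j, SHom (D j) (E j)) (j : J) :
    SHom ((F j).obj (Sum.elim X D)) ((F j).obj (Sum.elim Y E)) :=
  (F j).map (envMap f g)

theorem act_id (F : J → LCF (I ⊕ J)) (X : I → Dom) (D : J → Dom) (j : J) :
    act F (fun i => SHom.id (X i)) (fun j => SHom.id (D j)) j = SHom.id _ := by
  rw [act, envMap_id, map_id]

theorem act_comp (F : J → LCF (I ⊕ J)) {X Y Z : I → Dom} {D E G : J → Dom}
    (f' : ∀ i, SHom (Y i) (Z i)) (g' : ∀ j, SHom (E j) (G j))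
    (f : ∀ i, SHom (X i) (Y i)) (g : ∀ j, SHom (D j) (E j)) (j : J) :
    act F (fun i => (f' i).comp (f i)) (fun j => (g' j).comp (g j)) j =
      (act F f' g' j).comp (act F f g j) := by
  rw [act, envMap_comp, map_comp]
  rfl

theorem act_scott (F : J → LCF (I ⊕ J)) {α : Type} [CompletePartialOrder α]
    {X Y : I → Dom} {D E : J → Dom}
    {f : α → ∀ i, SHom (X i) (Y i)} {g : α → ∀ j, SHom (D j) (E j)}
    (hf : ScottContinuous f) (hg : ScottContinuous g) :
    ScottContinuous fun a j => act F (f a) (g a) j :=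
  scott_pi fun j => (envMap_scott hf hg).comp ((F j).map_cont _ _)

/-- Families of domains `obj 0, obj 1, …` with strict continuous maps between them. -/
structure Tower (J : Type) where
  obj : ℕ → J → Dom
  link : ∀ (n m : ℕ) (j : J), SHom (obj n j) (obj m j)

/-- The limit of the projections of a tower: its elements are the coherent sequences. -/
abbrev Limit (T : Tower J) (j : J) : Type :=
  {x : ∀ n, T.obj n j // ∀ n, T.link (n + 1) n j (x (n + 1)) = x n}

noncomputable instance (T : Tower J) (j : J) : OrderBot (Limit T j) where
  bot := ⟨⊥, fun _ => SHom.map_bot _⟩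
  bot_le x := fun n => bot_le

theorem limit_directed {T : Tower J} {j : J} {d : Set (Limit T j)} (hd : DirectedOn (· ≤ ·) d)
    (n : ℕ) : DirectedOn (· ≤ ·) ((fun x : Limit T j => x.1 n) '' d) :=
  directedOn_image (f := fun x : Limit T j => x.1 n)
    (fun a b (h : ∀ m, a.1 m ≤ b.1 m) => h n) hd

theorem limit_exists {T : Tower J} {j : J} {d : Set (Limit T j)} (hne : d.Nonempty)
    (hd : DirectedOn (· ≤ ·) d) :
    ∃ y : Limit T j, ∀ n, IsLUB ((fun x : Limit T j => x.1 n) '' d) (y.1 n) := by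
  refine ⟨⟨fun n => sSup ((fun x : Limit T j => x.1 n) '' d), fun n => ?_⟩,
    fun n => (limit_directed hd n).isLUB_sSup⟩
  have h := (T.link (n + 1) n j).scott (hne.image _) (limit_directed hd (n + 1))
    (limit_directed hd (n + 1)).isLUB_sSup
  rw [← image_comp] at h
  have he : ((T.link (n + 1) n j : T.obj (n + 1) j → T.obj n j) ∘
      fun x : Limit T j => x.1 (n + 1)) '' d = (fun x : Limit T j => x.1 n) '' d :=
    image_congr fun x _ => x.2 n
  rw [he] at h
  exact h.unique (limit_directed hd n).isLUB_sSup

theorem limit_isLUB {T : Tower J} {j : J} {d : Set (Limit T j)} {y : Limit T j}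
    (h : ∀ n, IsLUB ((fun x : Limit T j => x.1 n) '' d) (y.1 n)) : IsLUB d y :=
  ⟨fun x hx n => (h n).1 ⟨x, hx, rfl⟩, fun z hz n => (h n).2 (by
    rintro _ ⟨x, hx, rfl⟩
    exact hz hx n)⟩

noncomputable instance (T : Tower J) (j : J) : CompletePartialOrder (Limit T j) :=
  cpoOfExists (Limit T j) fun _ hne hd =>
    let ⟨y, hy⟩ := limit_exists hne hd
    ⟨y, limit_isLUB hy⟩

theorem limit_eval_scott (T : Tower J) (j : J) (n : ℕ) :
    ScottContinuous fun x : Limit T j => x.1 n := by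
  intro d hne hd a ha
  obtain ⟨y, hy⟩ := limit_exists hne hd
  rw [ha.unique (limit_isLUB hy)]
  exact hy n

theorem limit_scott {α : Type} [Preorder α] {T : Tower J} {j : J} {f : α → Limit T j}
    (h : ∀ n, ScottContinuous fun a => (f a).1 n) : ScottContinuous f := by
  intro d hne hd a ha
  refine limit_isLUB fun n => ?_
  rw [← image_comp]
  exact h n hne hd ha

/-- The limit of a tower, as a domain. -/
@[reducible] noncomputable def limObj (T : Tower J) (j : J) : Dom := ⟨Limit T j⟩

/-- The map between limits induced by a map of towers. -/
noncomputable def limMap (S T : Tower J) (f : ∀ n j, SHom (S.obj n j) (T.obj n j))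
    (hf : ∀ n m j, (T.link n m j).comp (f n j) = (f m j).comp (S.link n m j)) (j : J) :
    SHom (limObj S j) (limObj T j) where
  toFun x := ⟨fun n => f n j (x.1 n), fun n =>
    (DFunLike.congr_fun (hf (n + 1) n j) (x.1 (n + 1))).trans (congrArg (f n j) (x.2 n))⟩
  cont := limit_scott fun n => (limit_eval_scott S j n).comp (f n j).scott
  strict := Subtype.ext (funext fun n => (f n j).map_bot)

section Fix

variable (F : J → LCF (I ⊕ J))

/-- The iterates `F(X, -)^n` of the one-point domain. -/
noncomputable def chain (X : I → Dom) : ℕ → J → Dom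
  | 0 => fun _ => Dom.unit
  | n + 1 => fun j => (F j).obj (Sum.elim X (chain X n))

/-- The canonical maps between iterates: the embeddings for `n ≤ m` and the projections for
`m ≤ n`. They start with the unique strict maps from and to the one-point domain, and are then
obtained by applying `F(X, -)`. -/
noncomputable def link (X : I → Dom) : ∀ (n m : ℕ) (j : J), SHom (chain F X n j) (chain F X m j)
  | 0, _ => fun _ => ⊥
  | _ + 1, 0 => fun _ => ⊥
  | n + 1, m + 1 => fun j => act F (fun i => SHom.id (X i)) (link X n m) j

/-- The action on the iterates of a morphism of parameters. -/
noncomputable def chainMap {X Y : I → Dom} (f : ∀ i, SHom (X i) (Y i)) :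
    ∀ (n : ℕ) (j : J), SHom (chain F X n j) (chain F Y n j)
  | 0 => fun _ => ⊥
  | n + 1 => fun j => act F f (chainMap f n) j

theorem chainMap_link {X Y : I → Dom} (f : ∀ i, SHom (X i) (Y i)) :
    ∀ (n m : ℕ) (j : J),
      (link F Y n m j).comp (chainMap F f n j) = (chainMap F f m j).comp (link F X n m j)
  | 0, m, j => SHom.ext fun x => (SHom.map_bot (chainMap F f m j)).symm
  | n + 1, 0, j => SHom.ext fun x => rfl
  | n + 1, m + 1, j => by
    have ih : (fun j => (link F Y n m j).comp (chainMap F f n j)) =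
        fun j => (chainMap F f m j).comp (link F X n m j) := funext (chainMap_link f n m)
    have h1 := act_comp F (fun i => SHom.id (Y i)) (link F Y n m) f (chainMap F f n) j
    have h2 := act_comp F f (chainMap F f m) (fun i => SHom.id (X i)) (link F X n m) j
    rw [ih] at h1
    exact h1.symm.trans h2

theorem chainMap_id (X : I → Dom) :
    ∀ (n : ℕ) (j : J), chainMap F (fun i => SHom.id (X i)) n j = SHom.id _
  | 0, j => SHom.ext fun x => rfl
  | n + 1, j => by
    have ih : chainMap F (fun i => SHom.id (X i)) n = fun j => SHom.id _ :=
      funext (chainMap_id X n)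
    show act F _ (chainMap F _ n) j = _
    rw [ih]
    exact act_id F X _ j

theorem chainMap_comp {X Y Z : I → Dom} (g : ∀ i, SHom (Y i) (Z i)) (f : ∀ i, SHom (X i) (Y i)) :
    ∀ (n : ℕ) (j : J), chainMap F (fun i => (g i).comp (f i)) n j =
      (chainMap F g n j).comp (chainMap F f n j)
  | 0, j => SHom.ext fun x => rfl
  | n + 1, j => by
    have ih : chainMap F (fun i => (g i).comp (f i)) n =
        fun j => (chainMap F g n j).comp (chainMap F f n j) := funext (chainMap_comp g f n)
    show act F _ (chainMap F _ n) j = _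
    rw [ih]
    exact act_comp F g _ f _ j

theorem chainMap_scott (X Y : I → Dom) :
    ∀ n : ℕ, ScottContinuous fun f : ∀ i, SHom (X i) (Y i) => chainMap F f n
  | 0 => ScottContinuous.fun_const _
  | n + 1 => act_scott F ScottContinuous.fun_id (chainMap_scott X Y n)

/-- The iterates `F(X, -)^n` of the one-point domain, with their embeddings and projections. -/
noncomputable def tower (X : I → Dom) : Tower J := ⟨chain F X, link F X⟩

/-- The canonical parametrized fixed point of `F`: the bilimit of the iterates `F(X, -)^n`. A family
`F` indexed by `J` is solved simultaneously in its `J` recursion variables. -/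
noncomputable def fix (j : J) : LCF I where
  obj X := limObj (tower F X) j
  map {X Y} f := limMap (tower F X) (tower F Y) (chainMap F f) (chainMap_link F f) j
  map_id X := SHom.ext fun x => Subtype.ext (funext fun n =>
    DFunLike.congr_fun (chainMap_id F X n j) (x.1 n))
  map_comp g f := SHom.ext fun x => Subtype.ext (funext fun n =>
    DFunLike.congr_fun (chainMap_comp F g f n j) (x.1 n))
  map_cont X Y := SHom.scott_hom fun x => limit_scott fun n =>
    SHom.scott_app' ((chainMap_scott F X Y n).comp (scott_eval j)) (ScottContinuous.fun_const _)

variable (X : I → Dom)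

theorem link_self : ∀ (n : ℕ) (j : J), link F X n n j = SHom.id _
  | 0, j => SHom.ext fun x => rfl
  | n + 1, j => by
    have ih : link F X n n = fun j => SHom.id _ := funext (link_self n)
    show act F _ (link F X n n) j = _
    rw [ih]
    exact act_id F X _ j

theorem link_comp : ∀ (n m k : ℕ) (_ : min n k ≤ m) (j : J),
    (link F X m k j).comp (link F X n m j) = link F X n k j
  | 0, m, k, _, j => SHom.ext fun x => SHom.map_bot (link F X m k j)
  | n + 1, m, 0, _, j => by
    cases m <;> exact SHom.ext fun x => rfl
  | n + 1, 0, k + 1, h, j => by omega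
  | n + 1, m + 1, k + 1, h, j => by
    have ih : (fun j => (link F X m k j).comp (link F X n m j)) = link F X n k :=
      funext (link_comp n m k (by omega))
    have h1 := act_comp F (fun i => SHom.id (X i)) (link F X m k) (fun i => SHom.id (X i))
      (link F X n m) j
    rw [ih] at h1
    exact h1.symm

theorem act_mono {Y : I → Dom} {D E : J → Dom} (f : ∀ i, SHom (X i) (Y i))
    {g h : ∀ j, SHom (D j) (E j)} (hgh : g ≤ h) (j : J) : act F f g j ≤ act F f h j :=
  (act_scott F (ScottContinuous.fun_const f) ScottContinuous.fun_id).monotone hgh j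

theorem link_comp_le : ∀ (n m k : ℕ) (j : J),
    (link F X m k j).comp (link F X n m j) ≤ link F X n k j
  | 0, m, k, j => fun x => (SHom.map_bot (link F X m k j)).le
  | n + 1, 0, 0, j => fun x => le_rfl
  | n + 1, m + 1, 0, j => fun x => le_rfl
  | n + 1, 0, k + 1, j => fun x => bot_le (a := link F X (n + 1) (k + 1) j x)
  | n + 1, m + 1, k + 1, j => by
    have ih : (fun j => (link F X m k j).comp (link F X n m j)) ≤ link F X n k :=
      link_comp_le n m k
    have h1 := act_comp F (fun i => SHom.id (X i)) (link F X m k) (fun i => SHom.id (X i))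
      (link F X n m) j
    exact h1.symm.le.trans (act_mono F X _ ih j)

/-- The solution of the domain equation at the parameters `X`. -/
noncomputable abbrev fixObj (j : J) : Dom := (fix F j).obj X

/-- The projection of the bilimit to the `n`-th iterate. -/
noncomputable def limProj (n : ℕ) (j : J) : SHom (fixObj F X j) (chain F X n j) where
  toFun x := x.1 n
  cont := limit_eval_scott _ j n
  strict := rfl

/-- The embedding of the `n`-th iterate into the bilimit. -/
noncomputable def limEmb (n : ℕ) (j : J) : SHom (chain F X n j) (fixObj F X j) where
  toFun x := ⟨fun m => link F X n m j x, fun m =>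
    DFunLike.congr_fun (link_comp F X n (m + 1) m (by omega) j) x⟩
  cont := limit_scott fun m => (link F X n m j).scott
  strict := Subtype.ext (funext fun m => (link F X n m j).map_bot)

theorem limProj_comp_limEmb (n m : ℕ) (j : J) :
    (limProj F X m j).comp (limEmb F X n j) = link F X n m j :=
  SHom.ext fun _ => rfl

theorem link_comp_limProj {n m : ℕ} (h : n ≤ m) (j : J) :
    (link F X m n j).comp (limProj F X m j) = limProj F X n j := by
  induction m, h using Nat.le_induction with
  | base => rw [link_self]; rfl
  | succ m h ih =>
    rw [← link_comp F X (m + 1) m n (by omega) j]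
    refine SHom.ext fun x => ?_
    exact (congrArg (link F X m n j) (x.2 m)).trans (DFunLike.congr_fun ih x)

theorem limEmb_link_le (n m : ℕ) (j : J) :
    (limEmb F X m j).comp (link F X n m j) ≤ limEmb F X n j :=
  fun x k => link_comp_le F X n m k j x

/-- The isomorphism `F(X, fix F X) → fix F X`. -/
noncomputable def fold (j : J) : SHom ((F j).obj (Sum.elim X (fixObj F X))) (fixObj F X j) where
  toFun y := ⟨fun
    | 0 => ⊥
    | n + 1 => act F (fun i => SHom.id (X i)) (limProj F X n) j y, fun
    | 0 => rfl
    | n + 1 => by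
      have h1 := act_comp F (fun i => SHom.id (X i)) (link F X (n + 1) n)
        (fun i => SHom.id (X i)) (limProj F X (n + 1)) j
      have h2 : (fun j => (link F X (n + 1) n j).comp (limProj F X (n + 1) j)) = limProj F X n :=
        funext fun j => link_comp_limProj F X (Nat.le_succ n) j
      rw [h2] at h1
      exact (DFunLike.congr_fun h1 y).symm⟩
  cont := limit_scott fun
    | 0 => ScottContinuous.fun_const _
    | n + 1 => (act F (fun i => SHom.id (X i)) (limProj F X n) j).scott
  strict := Subtype.ext (funext fun
    | 0 => rfl
    | n + 1 => (act F (fun i => SHom.id (X i)) (limProj F X n) j).map_bot)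

/-- The `n`-th approximation to the inverse of `fold`. -/
noncomputable def unfoldApprox (n : ℕ) (j : J) :
    SHom (fixObj F X j) ((F j).obj (Sum.elim X (fixObj F X))) :=
  (act F (fun i => SHom.id (X i)) (limEmb F X n) j).comp (limProj F X (n + 1) j)

theorem unfoldApprox_mono (j : J) : Monotone fun n => unfoldApprox F X n j := by
  refine monotone_nat_of_le_succ fun n x => ?_
  have h1 := act_comp F (fun i => SHom.id (X i)) (limEmb F X n) (fun i => SHom.id (X i))
    (link F X (n + 1) n) j
  have h2 : (fun j => (limEmb F X n j).comp (link F X (n + 1) n j)) ≤ limEmb F X (n + 1) :=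
    fun j => limEmb_link_le F X (n + 1) n j
  have h3 := (congrArg (act F (fun i => SHom.id (X i)) (limEmb F X n) j) (x.2 (n + 1))).symm
  exact h3.le.trans ((DFunLike.congr_fun h1 (x.1 (n + 2))).symm.le.trans
    (act_mono F X _ h2 j (x.1 (n + 2))))

/-- The isomorphism `fix F X → F(X, fix F X)`, as the supremum of its approximations. -/
noncomputable def unfold (j : J) : SHom (fixObj F X j) ((F j).obj (Sum.elim X (fixObj F X))) :=
  SHom.sup (range fun n => unfoldApprox F X n j) (unfoldApprox_mono F X j).directed_le.directedOn_range

theorem unfold_isLUB (j : J) (x : fixObj F X j) :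
    IsLUB (range fun n => unfoldApprox F X n j x) (unfold F X j x) := by
  have h := (SHom.isLUB_iff (unfoldApprox_mono F X j).directed_le.directedOn_range).1
    (SHom.isLUB_sup _ (unfoldApprox_mono F X j).directed_le.directedOn_range) x
  rw [← range_comp] at h
  exact h

theorem limEmb_limProj_mono : Monotone fun n j => (limEmb F X n j).comp (limProj F X n j) := by
  refine monotone_nat_of_le_succ fun n j x => ?_
  have h := limEmb_link_le F X (n + 1) n j (x.1 (n + 1))
  exact (congrArg (limEmb F X n j) (x.2 n)).symm.le.trans h

theorem link_limProj_le (n m : ℕ) (j : J) (x : fixObj F X j) :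
    link F X n m j (x.1 n) ≤ x.1 m := by
  rcases le_total n m with h | h
  · have h1 := DFunLike.congr_fun (link_comp_limProj F X h j) x
    have h2 := link_comp_le F X m n m j (x.1 m)
    rw [link_self] at h2
    exact (congrArg (link F X n m j) h1).symm.le.trans h2
  · exact (DFunLike.congr_fun (link_comp_limProj F X h j) x).le

theorem limEmb_limProj_isLUB :
    IsLUB (range fun n j => (limEmb F X n j).comp (limProj F X n j))
      fun j => SHom.id (fixObj F X j) := by
  constructor
  · rintro _ ⟨n, rfl⟩ j x m
    exact link_limProj_le F X n m j x
  · intro g hg j x m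
    refine le_trans (le_of_eq ?_) (hg ⟨m, rfl⟩ j x m)
    show x.1 m = link F X m m j (x.1 m)
    rw [link_self]
    rfl

theorem unfold_fold (j : J) : (unfold F X j).comp (fold F X j) = SHom.id _ := by
  have hd := (limEmb_limProj_mono F X).directed_le.directedOn_range
  have h := act_scott F (α := ∀ j, SHom (fixObj F X j) (fixObj F X j))
    (ScottContinuous.fun_const fun i => SHom.id (X i)) ScottContinuous.fun_id
    (range_nonempty _) hd (limEmb_limProj_isLUB F X)
  refine SHom.ext fun y => ?_
  have h1 := (SHom.scott_app' (scott_eval j) (ScottContinuous.fun_const y))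
    ((range_nonempty _).image _) (directedOn_image
      (act_scott F (ScottContinuous.fun_const _) ScottContinuous.fun_id).monotone hd) h
  rw [← range_comp, ← range_comp] at h1
  change IsLUB _ (act F (fun i => SHom.id (X i)) (fun j => SHom.id (fixObj F X j)) j y) at h1
  rw [act_id] at h1
  refine (unfold_isLUB F X j (fold F X j y)).unique ?_
  convert h1 using 2
  funext n
  exact (DFunLike.congr_fun (act_comp F (fun i => SHom.id (X i)) (limEmb F X n)
    (fun i => SHom.id (X i)) (limProj F X n) j) y).symm

theorem fold_unfold (j : J) : (fold F X j).comp (unfold F X j) = SHom.id _ := by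
  refine SHom.ext fun x => Subtype.ext (funext fun m => ?_)
  cases m with
  | zero => rfl
  | succ m =>
    have hm : Monotone fun n => unfoldApprox F X n j x := fun a b hab => unfoldApprox_mono F X j hab x
    have h := (act F (fun i => SHom.id (X i)) (limProj F X m) j).scott (range_nonempty _)
      hm.directed_le.directedOn_range (unfold_isLUB F X j x)
    rw [← range_comp] at h
    have he : ∀ n, act F (fun i => SHom.id (X i)) (limProj F X m) j (unfoldApprox F X n j x) =
        link F X (n + 1) (m + 1) j (x.1 (n + 1)) := fun n =>
      (DFunLike.congr_fun (act_comp F (fun i => SHom.id (X i)) (limProj F X m)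
        (fun i => SHom.id (X i)) (limEmb F X n) j) (x.1 (n + 1))).symm
    refine h.unique ⟨?_, fun z hz => ?_⟩
    · rintro _ ⟨n, rfl⟩
      exact (he n).le.trans (link_limProj_le F X (n + 1) (m + 1) j x)
    · refine le_trans (le_of_eq ?_) (hz ⟨m, rfl⟩)
      refine Eq.trans ?_ (he m).symm
      rw [link_self]
      rfl

end Fix

/-! Solving domain equations commutes with substitution for the parameters. -/

/-- The extension of a substitution that leaves the recursion variables unchanged. -/
noncomputable def liftEnv (H : I → LCF K) : I ⊕ J → LCF (K ⊕ J)
  | .inl i => comp (H i) fun k => proj (.inl k)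
  | .inr j => proj (.inr j)

theorem map_heq (F : LCF I) {X X' Y Y' : I → Dom} {f : ∀ i, SHom (X i) (Y i)}
    {f' : ∀ i, SHom (X' i) (Y' i)} (hX : X = X') (hY : Y = Y') (hf : HEq f f') :
    HEq (F.map f) (F.map f') := by
  subst hX hY
  obtain rfl := eq_of_heq hf
  rfl

theorem liftEnv_obj (H : I → LCF K) (X : K → Dom) (D : J → Dom) :
    (fun s => (liftEnv (J := J) H s).obj (Sum.elim X D)) =
      Sum.elim (fun i => (H i).obj X) D := by
  funext s
  cases s <;> rfl

theorem act_heq (F : J → LCF (I ⊕ J)) (H : I → LCF K) {X Y : K → Dom} {D D' E E' : J → Dom}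
    (f : ∀ k, SHom (X k) (Y k)) {g : ∀ j, SHom (D j) (E j)} {g' : ∀ j, SHom (D' j) (E' j)}
    (hD : D = D') (hE : E = E') (hg : HEq g g') :
    HEq (act (fun j => comp (F j) (liftEnv H)) f g) (act F (fun i => (H i).map f) g') := by
  subst hD hE
  obtain rfl := eq_of_heq hg
  refine Function.hfunext rfl fun j j' hj => ?_
  obtain rfl := eq_of_heq hj
  refine map_heq (F j) (liftEnv_obj H X D) (liftEnv_obj H Y E) ?_
  refine Function.hfunext rfl fun s s' hs => ?_
  obtain rfl := eq_of_heq hs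
  cases s <;> rfl

section

variable (F : J → LCF (I ⊕ J)) (H : I → LCF K)

theorem chain_comp (X : K → Dom) :
    ∀ n, chain (fun j => comp (F j) (liftEnv H)) X n = chain F (fun i => (H i).obj X) n
  | 0 => rfl
  | n + 1 => funext fun j => by
    show (F j).obj (fun s => (liftEnv H s).obj (Sum.elim X _)) = _
    rw [liftEnv_obj, chain_comp X n]
    rfl

theorem bot_heq {D D' E E' : J → Dom} (hD : D = D') (hE : E = E') :
    HEq (fun j => (⊥ : SHom (D j) (E j))) (fun j => (⊥ : SHom (D' j) (E' j))) := by
  subst hD hE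
  rfl

theorem link_heq (X : K → Dom) : ∀ n m,
    HEq (link (fun j => comp (F j) (liftEnv H)) X n m) (link F (fun i => (H i).obj X) n m)
  | 0, m => bot_heq rfl (chain_comp F H X m)
  | n + 1, 0 => bot_heq (chain_comp F H X (n + 1)) rfl
  | n + 1, m + 1 => by
    have h := act_heq F H (fun k => SHom.id (X k)) (chain_comp F H X n) (chain_comp F H X m)
      (link_heq X n m)
    simp only [map_id] at h
    exact h

theorem chainMap_heq {X Y : K → Dom} (f : ∀ k, SHom (X k) (Y k)) : ∀ n,
    HEq (chainMap (fun j => comp (F j) (liftEnv H)) f n) (chainMap F (fun i => (H i).map f) n)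
  | 0 => HEq.rfl
  | n + 1 => act_heq F H f (chain_comp F H X n) (chain_comp F H Y n) (chainMap_heq f n)

theorem tower_comp (X : K → Dom) :
    tower (fun j => comp (F j) (liftEnv H)) X = tower F fun i => (H i).obj X := by
  have h1 : chain (fun j => comp (F j) (liftEnv H)) X = chain F fun i => (H i).obj X :=
    funext (chain_comp F H X)
  have h2 : HEq (link (fun j => comp (F j) (liftEnv H)) X) (link F fun i => (H i).obj X) := by
    refine Function.hfunext rfl fun n n' hn => ?_
    obtain rfl := eq_of_heq hn
    refine Function.hfunext rfl fun m m' hm => ?_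
    obtain rfl := eq_of_heq hm
    exact link_heq F H X n m
  unfold tower
  congr

theorem limMap_heq {S S' T T' : Tower J} (hS : S = S') (hT : T = T')
    {f : ∀ n j, SHom (S.obj n j) (T.obj n j)} {f' : ∀ n j, SHom (S'.obj n j) (T'.obj n j)}
    (hf : HEq f f') {h h'} (j : J) : HEq (limMap S T f h j) (limMap S' T' f' h' j) := by
  subst hS hT
  obtain rfl := eq_of_heq hf
  rfl

theorem fix_comp (j : J) : comp (fix F j) H = fix (fun j => comp (F j) (liftEnv H)) j := by
  symm
  refine hext (funext fun X => congrArg (fun T => limObj T j) (tower_comp F H X)) fun X Y f => ?_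
  refine limMap_heq (tower_comp F H X) (tower_comp F H Y) ?_
    (h := chainMap_link _ f) (h' := chainMap_link F fun i => (H i).map f) j
  refine Function.hfunext rfl fun n n' hn => ?_
  obtain rfl := eq_of_heq hn
  exact chainMap_heq F H f n

end

end LCF

/-! ### Session types and functional types -/

/-- Polarities of session types. The same type indexes the negative and positive aspects. -/
inductive Pol
  | neg
  | pos

/-- Channel names. -/
abbrev Chan := ℕ

/-- Choice labels. -/
abbrev Label := ℕ

/-- `TVar Ξ p`: a type variable of polarity `p` declared in `Ξ` (de Bruijn representation). -/
inductive TVar : List Pol → Pol → Type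
  | zero {Ξ : List Pol} {p : Pol} : TVar (p :: Ξ) p
  | succ {Ξ : List Pol} {p q : Pol} : TVar Ξ p → TVar (q :: Ξ) p

mutual

/-- `SType Ξ p`: the session types of polarity `p` with type variables in `Ξ`; the constructors are
the rules of type formation. -/
inductive SType : List Pol → Pol → Type
  | var {Ξ : List Pol} {p : Pol} : TVar Ξ p → SType Ξ p
  | one {Ξ : List Pol} : SType Ξ .pos
  | rho {Ξ : List Pol} {p : Pol} : SType (p :: Ξ) p → SType Ξ p
  | down {Ξ : List Pol} : SType Ξ .neg → SType Ξ .pos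
  | up {Ξ : List Pol} : SType Ξ .pos → SType Ξ .neg
  | plus {Ξ : List Pol} (L : Finset Label) (A : L → SType Ξ .pos) : SType Ξ .pos
  | amp {Ξ : List Pol} (L : Finset Label) (A : L → SType Ξ .neg) : SType Ξ .neg
  | tensor {Ξ : List Pol} (A B : SType Ξ .pos) : SType Ξ .pos
  | lolly {Ξ : List Pol} (A : SType Ξ .pos) (B : SType Ξ .neg) : SType Ξ .neg
  | and {Ξ : List Pol} (τ : FType) (A : SType Ξ .pos) : SType Ξ .pos
  | imp {Ξ : List Pol} (τ : FType) (A : SType Ξ .neg) : SType Ξ .neg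

/-- Functional types: `quo a A as As` is the type of quoted processes that provide `a : A` and use
the channels `as i : As i` (all names distinct). -/
inductive FType : Type
  | arr (τ σ : FType) : FType
  | quo {n : ℕ} (a : Chan) {p : Pol} (A : SType [] p) (as : Fin n ↪ Chan) {q : Fin n → Pol}
      (As : ∀ i, SType [] (q i)) (ha : ∀ i, as i ≠ a) : FType

end

/-! Renaming and substitution of type variables. -/

def TVar.lift {Ξ Θ : List Pol} (f : ∀ p, TVar Ξ p → TVar Θ p) (r : Pol) :
    ∀ p, TVar (r :: Ξ) p → TVar (r :: Θ) p
  | _, .zero => .zero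
  | _, .succ v => .succ (f _ v)

def SType.ren : ∀ {Ξ Θ : List Pol} {p : Pol}, (∀ p, TVar Ξ p → TVar Θ p) → SType Ξ p → SType Θ p
  | _, _, _, f, .var v => .var (f _ v)
  | _, _, _, _, .one => .one
  | _, _, _, f, .rho A => .rho (A.ren (TVar.lift f _))
  | _, _, _, f, .down A => .down (A.ren f)
  | _, _, _, f, .up A => .up (A.ren f)
  | _, _, _, f, .plus L A => .plus L fun l => (A l).ren f
  | _, _, _, f, .amp L A => .amp L fun l => (A l).ren f
  | _, _, _, f, .tensor A B => .tensor (A.ren f) (B.ren f)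
  | _, _, _, f, .lolly A B => .lolly (A.ren f) (B.ren f)
  | _, _, _, f, .and τ A => .and τ (A.ren f)
  | _, _, _, f, .imp τ A => .imp τ (A.ren f)

def SType.liftSubst {Ξ Θ : List Pol} (s : ∀ p, TVar Ξ p → SType Θ p) (r : Pol) :
    ∀ p, TVar (r :: Ξ) p → SType (r :: Θ) p
  | _, .zero => .var .zero
  | _, .succ v => (s _ v).ren fun _ => .succ

def SType.subst : ∀ {Ξ Θ : List Pol} {p : Pol}, (∀ p, TVar Ξ p → SType Θ p) → SType Ξ p → SType Θ p
  | _, _, _, s, .var v => s _ v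
  | _, _, _, _, .one => .one
  | _, _, _, s, .rho A => .rho (A.subst (SType.liftSubst s _))
  | _, _, _, s, .down A => .down (A.subst s)
  | _, _, _, s, .up A => .up (A.subst s)
  | _, _, _, s, .plus L A => .plus L fun l => (A l).subst s
  | _, _, _, s, .amp L A => .amp L fun l => (A l).subst s
  | _, _, _, s, .tensor A B => .tensor (A.subst s) (B.subst s)
  | _, _, _, s, .lolly A B => .lolly (A.subst s) (B.subst s)
  | _, _, _, s, .and τ A => .and τ (A.subst s)
  | _, _, _, s, .imp τ A => .imp τ (A.subst s)

/-- The substitution of `B` for the last declared variable. -/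
def SType.single {Ξ : List Pol} {r : Pol} (B : SType Ξ r) : ∀ p, TVar (r :: Ξ) p → SType Ξ p
  | _, .zero => B
  | _, .succ v => .var v

/-- `[ρα.A/α]A` -/
def SType.unroll {Ξ : List Pol} {p : Pol} (A : SType (p :: Ξ) p) : SType Ξ p :=
  A.subst (SType.single (.rho A))

/-! ### Interpretation of types -/

/-- The indices of the interpretation of a type variable context: each variable contributes a
negative and a positive aspect. -/
abbrev Idx (Ξ : List Pol) : Type := (Σ p, TVar Ξ p) × Pol

/-- Separation of the last declared variable. -/
def Idx.split {Ξ : List Pol} {r : Pol} : Idx (r :: Ξ) → Idx Ξ ⊕ Pol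
  | (⟨_, .zero⟩, q) => .inr q
  | (⟨_, .succ v⟩, q) => .inl (⟨_, v⟩, q)

/-- The functor with the last declared variable separated from the others. -/
noncomputable def splitLast {Ξ : List Pol} {r : Pol} (F : LCF (Idx (r :: Ξ))) : LCF (Idx Ξ ⊕ Pol) :=
  F.comp fun s => LCF.proj s.split

mutual

/-- The aspects `⟦Ξ ⊢ A⟧^q` of a session type. -/
noncomputable def SType.den : ∀ {Ξ : List Pol} {p : Pol}, SType Ξ p → Pol → LCF (Idx Ξ)
  | _, _, .var v, q => LCF.proj (⟨_, v⟩, q)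
  | _, _, .one, .neg => LCF.const _ Dom.unit
  | _, _, .one, .pos => LCF.const _ (Dom.lift Dom.unit)
  | _, _, .rho A, q => LCF.fix (fun r => splitLast (A.den r)) q
  | _, _, .down A, .neg => A.den .neg
  | _, _, .down A, .pos => (A.den .pos).lift
  | _, _, .up A, .neg => (A.den .neg).lift
  | _, _, .up A, .pos => A.den .pos
  | _, _, .plus _ A, .neg => LCF.pi fun l => (A l).den .neg
  | _, _, .plus _ A, .pos => LCF.sum fun l => (A l).den .pos
  | _, _, .amp _ A, .neg => LCF.sum fun l => (A l).den .neg
  | _, _, .amp _ A, .pos => LCF.pi fun l => (A l).den .pos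
  | _, _, .tensor A B, .neg => (A.den .neg).prod (B.den .neg)
  | _, _, .tensor A B, .pos => ((A.den .pos).prod (B.den .pos)).lift
  | _, _, .lolly A B, .neg => ((A.den .pos).prod (B.den .neg)).lift
  | _, _, .lolly A B, .pos => (A.den .neg).prod (B.den .pos)
  | _, _, .and _ A, .neg => A.den .neg
  | _, _, .and τ A, .pos => ((LCF.const _ τ.den).prod (A.den .pos)).lift
  | _, _, .imp τ A, .neg => ((LCF.const _ τ.den).prod (A.den .neg)).lift
  | _, _, .imp _ A, .pos => A.den .pos

/-- The domain `⟦τ⟧` of a functional type. -/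
noncomputable def FType.den : FType → Dom
  | .arr τ σ => Dom.sfn τ.den σ.den
  | .quo (n := n) _ A _ As _ =>
    let V : (Idx [] → Dom) := fun _ => Dom.unit
    Dom.lift (Dom.fn
      (Dom.prod (Dom.pi fun i : Fin n => ((As i).den .pos).obj V) ((A.den .neg).obj V))
      (Dom.prod (Dom.pi fun i : Fin n => ((As i).den .neg).obj V) ((A.den .pos).obj V)))

end

/-- Renaming is interpreted by reindexing. -/
theorem SType.den_ren : ∀ {Ξ Θ : List Pol} {p : Pol} (f : ∀ p, TVar Ξ p → TVar Θ p)
    (A : SType Ξ p) (q : Pol),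
    (A.ren f).den q = (A.den q).comp fun s => LCF.proj (⟨_, f _ s.1.2⟩, s.2)
  | _, _, _, f, .var v, q => rfl
  | _, _, _, _, .one, .neg => rfl
  | _, _, _, _, .one, .pos => rfl
  | _, _, _, f, .rho A, q => by
    have ih := fun r => A.den_ren (TVar.lift f _) r
    show LCF.fix (fun r => splitLast ((A.ren (TVar.lift f _)).den r)) q = LCF.comp (LCF.fix _ q) _
    rw [LCF.fix_comp]
    congr 1
    funext r
    rw [ih r]
    rw [splitLast, splitLast, LCF.comp_comp, LCF.comp_comp]
    congr 1
    funext ⟨⟨_, v⟩, q⟩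
    cases v <;> rfl
  | _, _, _, f, .down A, .neg => A.den_ren f .neg
  | _, _, _, f, .down A, .pos => congrArg LCF.lift (A.den_ren f .pos)
  | _, _, _, f, .up A, .neg => congrArg LCF.lift (A.den_ren f .neg)
  | _, _, _, f, .up A, .pos => A.den_ren f .pos
  | _, _, _, f, .plus _ A, .neg => congrArg LCF.pi (funext fun l => (A l).den_ren f .neg)
  | _, _, _, f, .plus _ A, .pos => congrArg LCF.sum (funext fun l => (A l).den_ren f .pos)
  | _, _, _, f, .amp _ A, .neg => congrArg LCF.sum (funext fun l => (A l).den_ren f .neg)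
  | _, _, _, f, .amp _ A, .pos => congrArg LCF.pi (funext fun l => (A l).den_ren f .pos)
  | _, _, _, f, .tensor A B, .neg => congrArg₂ LCF.prod (A.den_ren f .neg) (B.den_ren f .neg)
  | _, _, _, f, .tensor A B, .pos =>
    congrArg LCF.lift (congrArg₂ LCF.prod (A.den_ren f .pos) (B.den_ren f .pos))
  | _, _, _, f, .lolly A B, .neg =>
    congrArg LCF.lift (congrArg₂ LCF.prod (A.den_ren f .pos) (B.den_ren f .neg))
  | _, _, _, f, .lolly A B, .pos => congrArg₂ LCF.prod (A.den_ren f .neg) (B.den_ren f .pos)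
  | _, _, _, f, .and _ A, .neg => A.den_ren f .neg
  | _, _, _, f, .and τ A, .pos =>
    congrArg (fun G => ((LCF.const _ τ.den).prod G).lift) (A.den_ren f .pos)
  | _, _, _, f, .imp τ A, .neg =>
    congrArg (fun G => ((LCF.const _ τ.den).prod G).lift) (A.den_ren f .neg)
  | _, _, _, f, .imp _ A, .pos => A.den_ren f .pos

/-- Substitution is interpreted by composition. -/
theorem SType.den_subst : ∀ {Ξ Θ : List Pol} {p : Pol} (f : ∀ p, TVar Ξ p → SType Θ p)
    (A : SType Ξ p) (q : Pol),
    (A.subst f).den q = (A.den q).comp fun s => (f _ s.1.2).den s.2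
  | _, _, _, f, .var v, q => rfl
  | _, _, _, _, .one, .neg => rfl
  | _, _, _, _, .one, .pos => rfl
  | _, _, _, f, .rho A, q => by
    have ih := fun r => A.den_subst (SType.liftSubst f _) r
    show LCF.fix (fun r => splitLast ((A.subst (SType.liftSubst f _)).den r)) q = LCF.comp (LCF.fix _ q) _
    rw [LCF.fix_comp]
    congr 1
    funext r
    rw [ih r]
    rw [splitLast, splitLast, LCF.comp_comp, LCF.comp_comp]
    congr 1
    funext ⟨⟨_, v⟩, q⟩
    cases v with
    | zero => rfl
    | succ v =>
      show splitLast (((f _ v).ren fun _ => TVar.succ).den q) = _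
      rw [SType.den_ren, splitLast, LCF.comp_comp]
      rfl
  | _, _, _, f, .down A, .neg => A.den_subst f .neg
  | _, _, _, f, .down A, .pos => congrArg LCF.lift (A.den_subst f .pos)
  | _, _, _, f, .up A, .neg => congrArg LCF.lift (A.den_subst f .neg)
  | _, _, _, f, .up A, .pos => A.den_subst f .pos
  | _, _, _, f, .plus _ A, .neg => congrArg LCF.pi (funext fun l => (A l).den_subst f .neg)
  | _, _, _, f, .plus _ A, .pos => congrArg LCF.sum (funext fun l => (A l).den_subst f .pos)
  | _, _, _, f, .amp _ A, .neg => congrArg LCF.sum (funext fun l => (A l).den_subst f .neg)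
  | _, _, _, f, .amp _ A, .pos => congrArg LCF.pi (funext fun l => (A l).den_subst f .pos)
  | _, _, _, f, .tensor A B, .neg => congrArg₂ LCF.prod (A.den_subst f .neg) (B.den_subst f .neg)
  | _, _, _, f, .tensor A B, .pos =>
    congrArg LCF.lift (congrArg₂ LCF.prod (A.den_subst f .pos) (B.den_subst f .pos))
  | _, _, _, f, .lolly A B, .neg =>
    congrArg LCF.lift (congrArg₂ LCF.prod (A.den_subst f .pos) (B.den_subst f .neg))
  | _, _, _, f, .lolly A B, .pos => congrArg₂ LCF.prod (A.den_subst f .neg) (B.den_subst f .pos)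
  | _, _, _, f, .and _ A, .neg => A.den_subst f .neg
  | _, _, _, f, .and τ A, .pos =>
    congrArg (fun G => ((LCF.const _ τ.den).prod G).lift) (A.den_subst f .pos)
  | _, _, _, f, .imp τ A, .neg =>
    congrArg (fun G => ((LCF.const _ τ.den).prod G).lift) (A.den_subst f .neg)
  | _, _, _, f, .imp _ A, .pos => A.den_subst f .pos

/-- `⟦A⟧^q` for a closed session type `A`. -/
noncomputable def SType.dom {p : Pol} (A : SType [] p) (q : Pol) : Dom :=
  (A.den q).obj fun _ => Dom.unit

/-- The system of domain equations of a closed recursive type, one for each aspect. -/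
noncomputable def recSystem {p : Pol} (A : SType [p] p) (q : Pol) : LCF (Idx [] ⊕ Pol) :=
  splitLast (A.den q)

theorem SType.dom_unroll {p : Pol} (A : SType [p] p) (q : Pol) :
    (SType.unroll A).dom q = (recSystem A q).obj
      (Sum.elim (fun _ => Dom.unit) (LCF.fixObj (recSystem A) fun _ => Dom.unit)) := by
  unfold SType.dom SType.unroll
  rw [SType.den_subst]
  show (A.den q).obj _ = (A.den q).obj _
  congr 1
  funext ⟨⟨_, v⟩, r⟩
  cases v with
  | zero => rfl
  | succ v => cases v

/-- The identity between equal domains. -/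
def Hom.cast {D E : Dom} (h : D = E) : Hom D E := h ▸ Hom.id D

/-- `Fold^q : ⟦[ρα.A/α]A⟧^q → ⟦ρα.A⟧^q` -/
noncomputable def SType.foldHom {p : Pol} (A : SType [p] p) (q : Pol) :
    Hom ((SType.unroll A).dom q) ((SType.rho A).dom q) :=
  (LCF.fold (recSystem A) (fun _ => Dom.unit) q).toHom.comp (Hom.cast (SType.dom_unroll A q))

/-- `Unfold^q : ⟦ρα.A⟧^q → ⟦[ρα.A/α]A⟧^q` -/
noncomputable def SType.unfoldHom {p : Pol} (A : SType [p] p) (q : Pol) :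
    Hom ((SType.rho A).dom q) ((SType.unroll A).dom q) :=
  (Hom.cast (SType.dom_unroll A q).symm).comp (LCF.unfold (recSystem A) (fun _ => Dom.unit) q).toHom

/-! ### Contexts -/

/-- Closed session types of either polarity. -/
abbrev CType : Type := Σ p, SType [] p

/-- `⟦A⟧^q` -/
noncomputable def CType.dom (A : CType) (q : Pol) : Dom := A.2.dom q

/-- Linear contexts `c₁ : A₁, …, cₙ : Aₙ`, as (unordered) assignments of types to channel names. -/
abbrev CCtx : Type := Chan → Option CType

namespace CCtx

/-- The empty context. -/
def empty : CCtx := fun _ => none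

/-- The context `Δ, a : A`, for `a` not in `Δ`. -/
def ext (Δ : CCtx) (a : Chan) (A : CType) : CCtx := fun c => if c = a then some A else Δ c

/-- The context `Δ₁, Δ₂`, for disjoint `Δ₁` and `Δ₂`. -/
def union (Δ₁ Δ₂ : CCtx) : CCtx := fun c => (Δ₁ c).or (Δ₂ c)

/-- No channel name occurs in both contexts. -/
def Disjoint (Δ₁ Δ₂ : CCtx) : Prop := ∀ c, Δ₁ c = none ∨ Δ₂ c = none

/-- Only finitely many channel names occur in the context. -/
def Finite (Δ : CCtx) : Prop := {c | Δ c ≠ none}.Finite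

/-- The context `as 0 : As 0, …, as (n - 1) : As (n - 1)`. -/
noncomputable def ofNames {n : ℕ} (as : Fin n ↪ Chan) {q : Fin n → Pol}
    (As : ∀ i, SType [] (q i)) : CCtx :=
  Function.extend as (fun i => some ⟨q i, As i⟩) fun _ => none

end CCtx

/-- Structural contexts of functional variables (de Bruijn representation). -/
abbrev FCtx : Type := List FType

inductive FVar : FCtx → FType → Type
  | zero {Ψ : FCtx} {τ : FType} : FVar (τ :: Ψ) τ
  | succ {Ψ : FCtx} {τ σ : FType} : FVar Ψ τ → FVar (σ :: Ψ) τ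

/-! ### Terms and processes -/

mutual

/-- `Tm Ψ τ`: the functional terms `Ψ ⊢ M : τ`. -/
inductive Tm : FCtx → FType → Type
  | var {Ψ : FCtx} {τ : FType} : FVar Ψ τ → Tm Ψ τ
  | lam {Ψ : FCtx} {τ σ : FType} : Tm (τ :: Ψ) σ → Tm Ψ (.arr τ σ)
  | app {Ψ : FCtx} {τ σ : FType} : Tm Ψ (.arr τ σ) → Tm Ψ τ → Tm Ψ σ
  | fix {Ψ : FCtx} {τ : FType} : Tm (τ :: Ψ) τ → Tm Ψ τ
  | quo {Ψ : FCtx} {n : ℕ} {a : Chan} {p : Pol} {A : SType [] p} {as : Fin n ↪ Chan}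
      {q : Fin n → Pol} {As : ∀ i, SType [] (q i)} (ha : ∀ i, as i ≠ a) :
      Proc Ψ (CCtx.ofNames as As) a ⟨p, A⟩ → Tm Ψ (.quo a A as As ha)

/-- `Proc Ψ Δ c C`: the processes `Ψ; Δ ⊢ P :: c : C`. The constructors are the rules of process
formation; their side conditions state that the channel names in `Δ, c : C` are distinct and finite
in number. -/
inductive Proc : FCtx → CCtx → Chan → CType → Type
  | fwd {Ψ : FCtx} {A : CType} (a b : Chan) (hab : a ≠ b) : Proc Ψ (CCtx.empty.ext a A) b A
  | cut {Ψ : FCtx} {Δ₁ Δ₂ : CCtx} {c : Chan} {A C : CType} (a : Chan)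
      (hΔ : CCtx.Disjoint Δ₁ Δ₂) (ha : Δ₂ a = none) (hc : Δ₁ c = none) :
      Proc Ψ Δ₁ a A → Proc Ψ (Δ₂.ext a A) c C → Proc Ψ (Δ₁.union Δ₂) c C
  | close {Ψ : FCtx} (a : Chan) : Proc Ψ CCtx.empty a ⟨.pos, .one⟩
  | wait {Ψ : FCtx} {Δ : CCtx} {c : Chan} {C : CType} (a : Chan) (ha : Δ a = none) (hac : a ≠ c) :
      Proc Ψ Δ c C → Proc Ψ (Δ.ext a ⟨.pos, .one⟩) c C
  | downR {Ψ : FCtx} {Δ : CCtx} {a : Chan} {A : SType [] .neg} :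
      Proc Ψ Δ a ⟨.neg, A⟩ → Proc Ψ Δ a ⟨.pos, .down A⟩
  | downL {Ψ : FCtx} {Δ : CCtx} {c : Chan} {C : CType} {A : SType [] .neg} (a : Chan)
      (ha : Δ a = none) :
      Proc Ψ (Δ.ext a ⟨.neg, A⟩) c C → Proc Ψ (Δ.ext a ⟨.pos, .down A⟩) c C
  | upR {Ψ : FCtx} {Δ : CCtx} {a : Chan} {A : SType [] .pos} :
      Proc Ψ Δ a ⟨.pos, A⟩ → Proc Ψ Δ a ⟨.neg, .up A⟩
  | upL {Ψ : FCtx} {Δ : CCtx} {c : Chan} {C : CType} {A : SType [] .pos} (a : Chan)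
      (ha : Δ a = none) :
      Proc Ψ (Δ.ext a ⟨.pos, A⟩) c C → Proc Ψ (Δ.ext a ⟨.neg, .up A⟩) c C
  | plusR {Ψ : FCtx} {Δ : CCtx} {a : Chan} {L : Finset Label} {A : L → SType [] .pos} (k : L) :
      Proc Ψ Δ a ⟨.pos, A k⟩ → Proc Ψ Δ a ⟨.pos, .plus L A⟩
  | plusL {Ψ : FCtx} {Δ : CCtx} {c : Chan} {C : CType} {L : Finset Label} {A : L → SType [] .pos}
      (a : Chan) (hΔ : Δ.Finite) (ha : Δ a = none) (hc : Δ c = none) (hac : a ≠ c) :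
      (∀ l, Proc Ψ (Δ.ext a ⟨.pos, A l⟩) c C) → Proc Ψ (Δ.ext a ⟨.pos, .plus L A⟩) c C
  | ampR {Ψ : FCtx} {Δ : CCtx} {a : Chan} {L : Finset Label} {A : L → SType [] .neg}
      (hΔ : Δ.Finite) (ha : Δ a = none) :
      (∀ l, Proc Ψ Δ a ⟨.neg, A l⟩) → Proc Ψ Δ a ⟨.neg, .amp L A⟩
  | ampL {Ψ : FCtx} {Δ : CCtx} {c : Chan} {C : CType} {L : Finset Label} {A : L → SType [] .neg}
      (a : Chan) (ha : Δ a = none) (k : L) :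
      Proc Ψ (Δ.ext a ⟨.neg, A k⟩) c C → Proc Ψ (Δ.ext a ⟨.neg, .amp L A⟩) c C
  | tensorR {Ψ : FCtx} {Δ : CCtx} {a : Chan} {A B : SType [] .pos} (b : Chan) (hb : Δ b = none)
      (hba : b ≠ a) :
      Proc Ψ Δ a ⟨.pos, A⟩ → Proc Ψ (Δ.ext b ⟨.pos, B⟩) a ⟨.pos, .tensor B A⟩
  | tensorL {Ψ : FCtx} {Δ : CCtx} {c : Chan} {C : CType} {A B : SType [] .pos} (a b : Chan)
      (ha : Δ a = none) (hb : Δ b = none) (hba : b ≠ a) :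
      Proc Ψ ((Δ.ext a ⟨.pos, A⟩).ext b ⟨.pos, B⟩) c C →
        Proc Ψ (Δ.ext a ⟨.pos, .tensor B A⟩) c C
  | lollyR {Ψ : FCtx} {Δ : CCtx} {a : Chan} {B : SType [] .pos} {A : SType [] .neg} (b : Chan)
      (hb : Δ b = none) :
      Proc Ψ (Δ.ext b ⟨.pos, B⟩) a ⟨.neg, A⟩ → Proc Ψ Δ a ⟨.neg, .lolly B A⟩
  | lollyL {Ψ : FCtx} {Δ : CCtx} {c : Chan} {C : CType} {B : SType [] .pos} {A : SType [] .neg}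
      (a b : Chan) (ha : Δ a = none) (hb : Δ b = none) (hba : b ≠ a) (hbc : b ≠ c) :
      Proc Ψ (Δ.ext a ⟨.neg, A⟩) c C →
        Proc Ψ ((Δ.ext b ⟨.pos, B⟩).ext a ⟨.neg, .lolly B A⟩) c C
  | andR {Ψ : FCtx} {Δ : CCtx} {a : Chan} {τ : FType} {A : SType [] .pos} :
      Tm Ψ τ → Proc Ψ Δ a ⟨.pos, A⟩ → Proc Ψ Δ a ⟨.pos, .and τ A⟩
  | andL {Ψ : FCtx} {Δ : CCtx} {c : Chan} {C : CType} {τ : FType} {A : SType [] .pos} (a : Chan)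
      (ha : Δ a = none) :
      Proc (τ :: Ψ) (Δ.ext a ⟨.pos, A⟩) c C → Proc Ψ (Δ.ext a ⟨.pos, .and τ A⟩) c C
  | impR {Ψ : FCtx} {Δ : CCtx} {a : Chan} {τ : FType} {A : SType [] .neg} :
      Proc (τ :: Ψ) Δ a ⟨.neg, A⟩ → Proc Ψ Δ a ⟨.neg, .imp τ A⟩
  | impL {Ψ : FCtx} {Δ : CCtx} {c : Chan} {C : CType} {τ : FType} {A : SType [] .neg} (a : Chan)
      (ha : Δ a = none) :
      Tm Ψ τ → Proc Ψ (Δ.ext a ⟨.neg, A⟩) c C → Proc Ψ (Δ.ext a ⟨.neg, .imp τ A⟩) c C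
  | rhoR {Ψ : FCtx} {Δ : CCtx} {a : Chan} {p : Pol} {A : SType [p] p} :
      Proc Ψ Δ a ⟨p, A.unroll⟩ → Proc Ψ Δ a ⟨p, .rho A⟩
  | rhoL {Ψ : FCtx} {Δ : CCtx} {c : Chan} {C : CType} {p : Pol} {A : SType [p] p} (a : Chan)
      (ha : Δ a = none) :
      Proc Ψ (Δ.ext a ⟨p, A.unroll⟩) c C → Proc Ψ (Δ.ext a ⟨p, .rho A⟩) c C
  | unquo {Ψ : FCtx} {n : ℕ} {a : Chan} {p : Pol} {A : SType [] p} {as : Fin n ↪ Chan}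
      {q : Fin n → Pol} {As : ∀ i, SType [] (q i)} {ha : ∀ i, as i ≠ a} :
      Tm Ψ (.quo a A as As ha) → Proc Ψ (CCtx.ofNames as As) a ⟨p, A⟩

end

/-! ### Fixed points and the trace -/

namespace Hom

variable {Γ A B X : Dom}

/-- Currying. -/
def curry (f : Γ → A → B) (hf : ScottContinuous fun p : Γ × A => f p.1 p.2) :
    Hom Γ (Dom.fn A B) where
  toFun u := ⟨fun x => f u x, ((ScottContinuous.fun_const u).prodMk ScottContinuous.fun_id).comp hf⟩
  cont := scott_hom fun x => (ScottContinuous.fun_id.prodMk (ScottContinuous.fun_const x)).comp hf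

theorem scott_mk {α : Type} [Preorder α] {f : α → A → B} {h : ∀ a, ScottContinuous (f a)}
    (hf : ∀ x, ScottContinuous fun a => f a x) : ScottContinuous fun a => (⟨f a, h a⟩ : Hom A B) :=
  scott_hom hf

/-- `f ↦ f^n(⊥)` -/
noncomputable def iter (D : Dom) : ℕ → Hom (Dom.fn D D) D
  | 0 => ⟨fun _ => ⊥, ScottContinuous.fun_const ⊥⟩
  | n + 1 => ⟨fun f => f (iter D n f), scott_app' ScottContinuous.fun_id (iter D n).cont⟩

theorem iter_mono (D : Dom) : Monotone (iter D) := by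
  refine monotone_nat_of_le_succ fun n => ?_
  induction n with
  | zero => exact fun f => bot_le
  | succ n ih => exact fun f => Hom.mono f (ih f)

/-- The least-fixed-point operator `fix f = ⨆ n, f^n(⊥)`. -/
noncomputable def fix (D : Dom) : Hom (Dom.fn D D) D :=
  sup (range (iter D)) (iter_mono D).directed_le.directedOn_range

/-- The parametrized least fixed point `f† a = fix (λ x. f (a, x))`. -/
noncomputable def dagger (f : Hom (Dom.prod A X) X) : Hom A X where
  toFun a := fix X ⟨fun x => f (a, x),
    ((ScottContinuous.fun_const a).prodMk ScottContinuous.fun_id).comp f.cont⟩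
  cont := (scott_mk fun x =>
    (ScottContinuous.fun_id.prodMk (ScottContinuous.fun_const x)).comp f.cont).comp (fix X).cont

/-- The trace `Tr f = π_B ∘ f ∘ ⟨id, (π_X ∘ f)†⟩`. -/
noncomputable def trace (f : Hom (Dom.prod A X) (Dom.prod B X)) : Hom A B where
  toFun a := (f (a, dagger ⟨fun z => (f z).2, f.cont.comp ScottContinuous.snd⟩ a)).1
  cont := ((ScottContinuous.fun_id.prodMk (dagger _).cont).comp f.cont).comp ScottContinuous.fst

theorem scott_trace : ScottContinuous fun f : Hom (Dom.prod A X) (Dom.prod B X) => trace f := by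
  refine scott_hom fun a => ?_
  refine (scott_app' (D := Dom.prod A X) (E := Dom.prod B X) ScottContinuous.fun_id
    ((ScottContinuous.fun_const a).prodMk ?_)).comp ScottContinuous.fst
  refine ScottContinuous.comp (g := fix X) (scott_mk fun x => ?_) (fix X).cont
  exact (scott_app' (D := Dom.prod A X) (E := Dom.prod B X) ScottContinuous.fun_id
    (ScottContinuous.fun_const (a, x))).comp ScottContinuous.snd

/-- The map into an indexed product with the given components. -/
def pi {ι : Type} {D : ι → Dom} (f : ∀ i, Hom A (D i)) : Hom A (Dom.pi D) :=
  ⟨fun x i => f i x, scott_pi fun i => (f i).cont⟩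

def proj {ι : Type} (D : ι → Dom) (i : ι) : Hom (Dom.pi D) (D i) := ⟨fun x => x i, scott_eval i⟩

def fst (A B : Dom) : Hom (Dom.prod A B) A := ⟨Prod.fst, ScottContinuous.fst⟩

def snd (A B : Dom) : Hom (Dom.prod A B) B := ⟨Prod.snd, ScottContinuous.snd⟩

end Hom

/-! ### Interpretation of contexts -/

/-- `⟦A⟧^q`, or the one-point domain for an absent channel. -/
noncomputable def optDom : Option CType → Pol → Dom
  | none, _ => Dom.unit
  | some A, q => A.dom q

namespace CCtx

/-- `⟦Δ⟧^q`: the product of the domains `⟦A⟧^q` over the channels `c : A` of `Δ`. (The index set is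
that of all channel names, and the factors of the names outside of `Δ` are one-point domains.) -/
noncomputable def dom (Δ : CCtx) (q : Pol) : Dom := Dom.pi fun c => optDom (Δ c) q

variable (Δ Δ₁ Δ₂ : CCtx) (q : Pol)

/-- The component of `⟦Δ⟧^q` at a channel `a : A` of `Δ`. -/
noncomputable def get {Δ : CCtx} {a : Chan} {A : CType} (h : Δ a = some A) :
    Hom (Δ.dom q) (A.dom q) :=
  (Hom.cast (congrArg (fun o => optDom o q) h)).comp (Hom.proj _ a)

open Classical in
/-- The projection of `⟦Δ⟧^q` to the product over the channels that occur in `Δ` and `Δ'` with the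
same type. -/
noncomputable def restrict (Δ Δ' : CCtx) (q : Pol) : Hom (Δ.dom q) (Δ'.dom q) :=
  Hom.pi fun c =>
    if h : Δ c = Δ' c then (Hom.cast (congrArg (fun o => optDom o q) h)).comp (Hom.proj _ c) else ⊥

theorem ext_self (a : Chan) (A : CType) : Δ.ext a A a = some A := if_pos rfl

/-- `⟦Δ, a : A⟧^q → ⟦Δ⟧^q × ⟦a : A⟧^q` -/
noncomputable def unext (a : Chan) (A : CType) :
    Hom ((Δ.ext a A).dom q) (Dom.prod (Δ.dom q) (A.dom q)) where
  toFun x := (restrict (Δ.ext a A) Δ q x, get q (ext_self Δ a A) x)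
  cont := (Hom.cont _).prodMk (Hom.cont _)

/-- `⟦Δ⟧^q × ⟦a : A⟧^q → ⟦Δ, a : A⟧^q` -/
noncomputable def mkExt (a : Chan) (A : CType) :
    Hom (Dom.prod (Δ.dom q) (A.dom q)) ((Δ.ext a A).dom q) :=
  Hom.pi fun c =>
    if h : c = a then
      (Hom.cast (congrArg (fun o => optDom o q) (show some A = Δ.ext a A c from
        (if_pos h).symm))).comp (Hom.snd _ _)
    else
      (Hom.cast (congrArg (fun o => optDom o q) (show Δ c = Δ.ext a A c from
        (if_neg h).symm))).comp ((Hom.proj _ c).comp (Hom.fst _ _))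

/-- `⟦Δ, a : A, b : B⟧^q → (⟦Δ⟧^q × ⟦a : A⟧^q) × ⟦b : B⟧^q` -/
noncomputable def unext2 (a : Chan) (A : CType) (b : Chan) (B : CType) :
    Hom (((Δ.ext a A).ext b B).dom q) (Dom.prod (Dom.prod (Δ.dom q) (A.dom q)) (B.dom q)) where
  toFun x := (unext Δ q a A (unext (Δ.ext a A) q b B x).1, (unext (Δ.ext a A) q b B x).2)
  cont := ((((unext (Δ.ext a A) q b B).cont.comp ScottContinuous.fst).comp
    (unext Δ q a A).cont)).prodMk ((unext (Δ.ext a A) q b B).cont.comp ScottContinuous.snd)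

/-- `(⟦Δ⟧^q × ⟦a : A⟧^q) × ⟦b : B⟧^q → ⟦Δ, a : A, b : B⟧^q` -/
noncomputable def mkExt2 (a : Chan) (A : CType) (b : Chan) (B : CType) :
    Hom (Dom.prod (Dom.prod (Δ.dom q) (A.dom q)) (B.dom q)) (((Δ.ext a A).ext b B).dom q) where
  toFun x := mkExt (Δ.ext a A) q b B (mkExt Δ q a A x.1, x.2)
  cont := ((ScottContinuous.fst.comp (mkExt Δ q a A).cont).prodMk ScottContinuous.snd).comp
    (mkExt (Δ.ext a A) q b B).cont

/-- `⟦Δ₁, Δ₂⟧^q → ⟦Δ₁⟧^q × ⟦Δ₂⟧^q` -/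
noncomputable def unUnion : Hom ((Δ₁.union Δ₂).dom q) (Dom.prod (Δ₁.dom q) (Δ₂.dom q)) where
  toFun x := (restrict (Δ₁.union Δ₂) Δ₁ q x, restrict (Δ₁.union Δ₂) Δ₂ q x)
  cont := (Hom.cont _).prodMk (Hom.cont _)

/-- The choice of the component of a channel in `Δ₁, Δ₂`: that of `Δ₁` if the channel occurs there,
and that of `Δ₂` otherwise. -/
noncomputable def orHom : ∀ o₁ o₂ : Option CType,
    Hom (Dom.prod (optDom o₁ q) (optDom o₂ q)) (optDom (o₁.or o₂) q)
  | none, _ => Hom.snd _ _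
  | some _, _ => Hom.fst _ _

/-- `⟦Δ₁⟧^q × ⟦Δ₂⟧^q → ⟦Δ₁, Δ₂⟧^q` -/
noncomputable def mkUnion : Hom (Dom.prod (Δ₁.dom q) (Δ₂.dom q)) ((Δ₁.union Δ₂).dom q) where
  toFun x c := orHom q (Δ₁ c) (Δ₂ c) (x.1 c, x.2 c)
  cont := scott_pi fun c =>
    ((ScottContinuous.fst.comp (scott_eval (β := fun c => optDom (Δ₁ c) q) c)).prodMk
      (ScottContinuous.snd.comp (scott_eval (β := fun c => optDom (Δ₂ c) q) c))).comp
        (orHom q (Δ₁ c) (Δ₂ c)).cont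

section

variable {n : ℕ} (as : Fin n ↪ Chan) {r : Fin n → Pol} (As : ∀ i, SType [] (r i))

/-- The product over the list `As`. -/
noncomputable abbrev listDom : Dom := Dom.pi fun i => (As i).dom q

theorem ofNames_apply (i : Fin n) : ofNames as As (as i) = some ⟨r i, As i⟩ :=
  as.injective.extend_apply _ _ i

/-- The product over `a₁ : A₁, …, aₙ : Aₙ`, indexed by positions instead of channel names. -/
noncomputable def unNames : Hom ((ofNames as As).dom q) (listDom q As) :=
  Hom.pi fun i => get q (ofNames_apply as As i)

open Classical in
/-- The inverse of `unNames`. -/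
noncomputable def mkNames : Hom (listDom q As) ((ofNames as As).dom q) :=
  Hom.pi fun c =>
    if h : ∃ i, as i = c then
      (Hom.cast (congrArg (fun o => optDom o q) (show some ⟨r h.choose, As h.choose⟩ =
        ofNames as As c from
          (ofNames_apply as As h.choose).symm.trans (congrArg _ h.choose_spec)))).comp
        (Hom.proj (fun i => (As i).dom q) h.choose)
    else ⊥

end

end CCtx

/-- `⟦Δ ⊢ c : C⟧ = [⟦Δ⟧^+ × ⟦c : C⟧^- → ⟦Δ⟧^- × ⟦c : C⟧^+]` -/
noncomputable abbrev seqDom (Δ : CCtx) (C : CType) : Dom :=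
  Dom.fn (Dom.prod (Δ.dom .pos) (C.dom .neg)) (Dom.prod (Δ.dom .neg) (C.dom .pos))

/-- `⟦Ψ⟧` -/
noncomputable def FCtx.dom : FCtx → Dom
  | [] => Dom.unit
  | τ :: Ψ => Dom.prod (FCtx.dom Ψ) τ.den

noncomputable def FVar.den : ∀ {Ψ : FCtx} {τ : FType}, FVar Ψ τ → Hom (FCtx.dom Ψ) τ.den
  | _, _, .zero => Hom.snd _ _
  | _, _, .succ v => v.den.comp (Hom.fst _ _)

/-! ### The semantic clauses

Each operator below is the interpretation of a rule, for arbitrary domains in the place of the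
interpretations of the contexts and types. An input `x` has the form `(δ⁺, c⁻)`, where `δ⁺` ends with
the component `a⁺` if the rule acts on a channel `a` in the linear context; an output has the form
`(δ⁻, c⁺)`. -/

namespace Sem

attribute [local fun_prop] scott_strictOn scott_coe scott_down

variable {Γ T Dp Dn Dp' Dn' Cn Cp An Ap Bn Bp : Dom}

/-- Application. -/
noncomputable def ap {D E : Dom} (f : Hom D E) (x : D) : E := f x

@[local fun_prop]
theorem scott_ap {α : Type} [Preorder α] {D E : Dom} (f : Hom D E) {g : α → D}
    (hg : ScottContinuous g) : ScottContinuous fun a => ap f (g a) :=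
  hg.comp f.cont

/-- Continuous functions `Γ → [Δ⁺ × C⁻ → Δ⁻ × C⁺]`. -/
abbrev Pr (Γ Dp Dn Cn Cp : Dom) : Type := Hom Γ (Dom.fn (Dom.prod Dp Cn) (Dom.prod Dn Cp))

/-- The output of `P` in the environment `u` on the input `x`. -/
noncomputable def run (P : Pr Γ Dp Dn Cn Cp) (u : Γ) (x : Dom.prod Dp Cn) : Dom.prod Dn Cp := P u x

@[local fun_prop]
theorem scott_run {α : Type} [Preorder α] (P : Pr Γ Dp Dn Cn Cp) {f : α → Γ}
    {g : α → Dom.prod Dp Cn} (hf : ScottContinuous f) (hg : ScottContinuous g) :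
    ScottContinuous fun a => run P (f a) (g a) :=
  Hom.scott_app' (hf.comp P.cont) hg

/-- Conversion along maps between interpretations of contexts. -/
noncomputable def dimap (i : Hom Dp' Dp) (o : Hom Dn Dn') (P : Pr Γ Dp Dn Cn Cp) : Pr Γ Dp' Dn' Cn Cp :=
  Hom.curry (fun u x => let y := run P u (ap i x.1, x.2); (ap o y.1, y.2)) (by fun_prop)

/-- A process with `a : A` in its context, with the component at `a` singled out. -/
noncomputable def open1 {Δ : CCtx} (a : Chan) (A : CType)
    (P : Pr Γ ((Δ.ext a A).dom .pos) ((Δ.ext a A).dom .neg) Cn Cp) :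
    Pr Γ (Dom.prod (Δ.dom .pos) (A.dom .pos)) (Dom.prod (Δ.dom .neg) (A.dom .neg)) Cn Cp :=
  dimap (CCtx.mkExt Δ .pos a A) (CCtx.unext Δ .neg a A) P

/-- The inverse of `open1`. -/
noncomputable def close1 {Δ : CCtx} (a : Chan) (A : CType)
    (P : Pr Γ (Dom.prod (Δ.dom .pos) (A.dom .pos)) (Dom.prod (Δ.dom .neg) (A.dom .neg)) Cn Cp) :
    Pr Γ ((Δ.ext a A).dom .pos) ((Δ.ext a A).dom .neg) Cn Cp :=
  dimap (CCtx.unext Δ .pos a A) (CCtx.mkExt Δ .neg a A) P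

/-- `open1` for two channels. -/
noncomputable def open2 {Δ : CCtx} (a : Chan) (A : CType) (b : Chan) (B : CType)
    (P : Pr Γ (((Δ.ext a A).ext b B).dom .pos) (((Δ.ext a A).ext b B).dom .neg) Cn Cp) :
    Pr Γ (Dom.prod (Dom.prod (Δ.dom .pos) (A.dom .pos)) (B.dom .pos))
      (Dom.prod (Dom.prod (Δ.dom .neg) (A.dom .neg)) (B.dom .neg)) Cn Cp :=
  dimap (CCtx.mkExt2 Δ .pos a A b B) (CCtx.unext2 Δ .neg a A b B) P

/-- `close1` for two channels. -/
noncomputable def close2 {Δ : CCtx} (a : Chan) (A : CType) (b : Chan) (B : CType)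
    (P : Pr Γ (Dom.prod (Dom.prod (Δ.dom .pos) (A.dom .pos)) (B.dom .pos))
      (Dom.prod (Dom.prod (Δ.dom .neg) (A.dom .neg)) (B.dom .neg)) Cn Cp) :
    Pr Γ (((Δ.ext a A).ext b B).dom .pos) (((Δ.ext a A).ext b B).dom .neg) Cn Cp :=
  dimap (CCtx.unext2 Δ .pos a A b B) (CCtx.mkExt2 Δ .neg a A b B) P

noncomputable def fwd : Pr Γ (Dom.prod Dp Ap) (Dom.prod Dn An) An Ap :=
  Hom.curry (fun _ x => ((⊥, x.2), x.1.2)) (by fun_prop)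

/-- The maps `f` and `g` side by side, with the channel `a⁻ × a⁺` that connects them singled out. -/
noncomputable def par (f : Hom (Dom.prod Dp An) (Dom.prod Dn Ap))
    (g : Hom (Dom.prod (Dom.prod Dp' Ap) Cn) (Dom.prod (Dom.prod Dn' An) Cp)) :
    Hom (Dom.prod (Dom.prod (Dom.prod Dp Dp') Cn) (Dom.prod An Ap))
      (Dom.prod (Dom.prod (Dom.prod Dn Dn') Cp) (Dom.prod An Ap)) where
  toFun z :=
    let y := ap f (z.1.1.1, z.2.1)
    let w := ap g ((z.1.1.2, z.2.2), z.1.2)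
    (((y.1, w.1.1), w.2), (w.1.2, y.2))
  cont := by fun_prop

noncomputable def cut (P : Pr Γ Dp Dn An Ap)
    (Q : Pr Γ (Dom.prod Dp' Ap) (Dom.prod Dn' An) Cn Cp) :
    Pr Γ (Dom.prod Dp Dp') (Dom.prod Dn Dn') Cn Cp where
  toFun u := Hom.trace (par (P u) (Q u))
  cont := by
    refine ScottContinuous.comp (f := fun u => par (P u) (Q u)) ?_ Hom.scott_trace
    refine Hom.scott_hom fun z => ?_
    show ScottContinuous fun u =>
      let y := run P u (z.1.1.1, z.2.1)
      let w := run Q u ((z.1.1.2, z.2.2), z.1.2)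
      (((y.1, w.1.1), w.2), (w.1.2, y.2))
    fun_prop

noncomputable def close : Pr Γ Dp Dn Dom.unit (Dom.lift Dom.unit) :=
  Hom.curry (fun _ _ => (⊥, ((⟨⟩ : PUnit) : WithBot PUnit))) (by fun_prop)

noncomputable def wait (P : Pr Γ Dp Dn Cn Cp) :
    Pr Γ (Dom.prod Dp (Dom.lift Dom.unit)) (Dom.prod Dn Dom.unit) Cn Cp :=
  Hom.curry (fun u x =>
    let y := run P u (x.1.1, x.2)
    strictOn x.1.2 ((y.1, ⊥), y.2)) (by fun_prop)

noncomputable def downR (P : Pr Γ Dp Dn An Ap) : Pr Γ Dp Dn An (Dom.lift Ap) :=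
  Hom.curry (fun u x => let y := run P u x; (y.1, (y.2 : WithBot Ap))) (by fun_prop)

noncomputable def downL (P : Pr Γ (Dom.prod Dp Ap) (Dom.prod Dn An) Cn Cp) :
    Pr Γ (Dom.prod Dp (Dom.lift Ap)) (Dom.prod Dn An) Cn Cp :=
  Hom.curry (fun u x => strictOn x.1.2 (run P u ((x.1.1, down x.1.2), x.2))) (by fun_prop)

noncomputable def upR (P : Pr Γ Dp Dn An Ap) : Pr Γ Dp Dn (Dom.lift An) Ap :=
  Hom.curry (fun u x => strictOn x.2 (run P u (x.1, down x.2))) (by fun_prop)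

noncomputable def upL (P : Pr Γ (Dom.prod Dp Ap) (Dom.prod Dn An) Cn Cp) :
    Pr Γ (Dom.prod Dp Ap) (Dom.prod Dn (Dom.lift An)) Cn Cp :=
  Hom.curry (fun u x => let y := run P u x; ((y.1.1, (y.1.2 : WithBot An)), y.2)) (by fun_prop)

section Choice

variable {ι : Type} {Fn Fp : ι → Dom}

/-- The injection `p ↦ (k, ↑p)` -/
noncomputable def inj (k : ι) : Hom (Fp k) (Dom.sum Fp) :=
  ⟨fun p => ((⟨k, p⟩ : Σ i, Fp i) : WithBot (Σ i, Fp i)),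
    ScottContinuous.comp (f := fun p => (⟨k, p⟩ : Σ i, Fp i)) (scott_sigmaMk (α := fun i => Fp i) k)
      scott_coe⟩

/-- `p ↦ (k : p, l ≠ k : ⊥)` -/
noncomputable def single [DecidableEq ι] (k : ι) : Hom (Fp k) (Dom.pi Fp) :=
  ⟨fun p => Function.update ⊥ k p, scott_update (β := fun i => Fp i) k⟩

noncomputable def plusR (k : ι) (P : Pr Γ Dp Dn (Fn k) (Fp k)) :
    Pr Γ Dp Dn (Dom.pi Fn) (Dom.sum Fp) :=
  Hom.curry (fun u x =>
    let y := run P u (x.1, ap (Hom.proj Fn k) x.2)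
    (y.1, ap (inj k) y.2)) (by fun_prop)

noncomputable def ampL (k : ι) (P : Pr Γ (Dom.prod Dp (Fp k)) (Dom.prod Dn (Fn k)) Cn Cp) :
    Pr Γ (Dom.prod Dp (Dom.pi Fp)) (Dom.prod Dn (Dom.sum Fn)) Cn Cp :=
  Hom.curry (fun u x =>
    let y := run P u ((x.1.1, ap (Hom.proj Fp k) x.1.2), x.2)
    ((y.1.1, ap (inj k) y.1.2), y.2)) (by fun_prop)

theorem scott_onUp_sigma {α β : Type} [Preorder α] [PartialOrder β] [OrderBot β]
    {t : α → WithBot (Σ i, Fp i)} {f : α → (Σ i, Fp i) → β} (ht : ScottContinuous t)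
    (hf : ∀ i, ScottContinuous fun p : α × Fp i => f p.1 ⟨i, p.2⟩) :
    ScottContinuous fun x => onUp (t x) (f x) := by
  refine scott_onUp ht (ScottContinuous.fromProd (fun x => ?_) fun w => ?_)
  · exact scott_sigma fun i =>
      ((ScottContinuous.fun_const x).prodMk ScottContinuous.fun_id).comp (hf i)
  · exact (ScottContinuous.fun_id.prodMk (ScottContinuous.fun_const w.2)).comp (hf w.1)

noncomputable def plusL [DecidableEq ι]
    (P : ∀ i, Pr Γ (Dom.prod Dp (Fp i)) (Dom.prod Dn (Fn i)) Cn Cp) :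
    Pr Γ (Dom.prod Dp (Dom.sum Fp)) (Dom.prod Dn (Dom.pi Fn)) Cn Cp :=
  Hom.curry (fun u x => onUp x.1.2 fun p =>
    let y := run (P p.1) u ((x.1.1, p.2), x.2)
    ((y.1.1, ap (single p.1) y.1.2), y.2))
    (scott_onUp_sigma (by fun_prop) fun i => by dsimp only; fun_prop)

noncomputable def ampR [DecidableEq ι] (P : ∀ i, Pr Γ Dp Dn (Fp i) (Fn i)) :
    Pr Γ Dp Dn (Dom.sum Fp) (Dom.pi Fn) :=
  Hom.curry (fun u x => onUp x.2 fun p =>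
    let y := run (P p.1) u (x.1, p.2)
    (y.1, ap (single p.1) y.2))
    (scott_onUp_sigma (by fun_prop) fun i => by dsimp only; fun_prop)

end Choice

noncomputable def tensorR (P : Pr Γ Dp Dn An Ap) :
    Pr Γ (Dom.prod Dp Bp) (Dom.prod Dn Bn) (Dom.prod Bn An) (Dom.lift (Dom.prod Bp Ap)) :=
  Hom.curry (fun u x =>
    let y := run P u (x.1.1, x.2.2)
    ((y.1, x.2.1), (((x.1.2, y.2) : Bp × Ap) : WithBot (Bp × Ap)))) (by fun_prop)

noncomputable def tensorL
    (P : Pr Γ (Dom.prod (Dom.prod Dp Ap) Bp) (Dom.prod (Dom.prod Dn An) Bn) Cn Cp) :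
    Pr Γ (Dom.prod Dp (Dom.lift (Dom.prod Bp Ap))) (Dom.prod Dn (Dom.prod Bn An)) Cn Cp :=
  Hom.curry (fun u x => onUp x.1.2 fun p =>
    let y := run P u (((x.1.1, p.2), p.1), x.2)
    ((y.1.1.1, (y.1.2, y.1.1.2)), y.2)) (scott_onUp (by fun_prop) (by fun_prop))

noncomputable def lollyR (P : Pr Γ (Dom.prod Dp Bp) (Dom.prod Dn Bn) An Ap) :
    Pr Γ Dp Dn (Dom.lift (Dom.prod Bp An)) (Dom.prod Bn Ap) :=
  Hom.curry (fun u x => onUp x.2 fun p =>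
    let y := run P u ((x.1, p.1), p.2)
    (y.1.1, (y.1.2, y.2))) (scott_onUp (by fun_prop) (by fun_prop))

noncomputable def lollyL (P : Pr Γ (Dom.prod Dp Ap) (Dom.prod Dn An) Cn Cp) :
    Pr Γ (Dom.prod (Dom.prod Dp Bp) (Dom.prod Bn Ap))
      (Dom.prod (Dom.prod Dn Bn) (Dom.lift (Dom.prod Bp An))) Cn Cp :=
  Hom.curry (fun u x =>
    let y := run P u ((x.1.1.1, x.1.2.2), x.2)
    (((y.1.1, x.1.2.1), (((x.1.1.2, y.1.2) : Bp × An) : WithBot (Bp × An))), y.2)) (by fun_prop)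

noncomputable def andR (M : Hom Γ T) (P : Pr Γ Dp Dn An Ap) :
    Pr Γ Dp Dn An (Dom.lift (Dom.prod T Ap)) :=
  Hom.curry (fun u x =>
    let v := ap M u
    let y := run P u x
    strictOn v (y.1, (((v, y.2) : T × Ap) : WithBot (T × Ap)))) (by fun_prop)

noncomputable def andL (P : Pr (Dom.prod Γ T) (Dom.prod Dp Ap) (Dom.prod Dn An) Cn Cp) :
    Pr Γ (Dom.prod Dp (Dom.lift (Dom.prod T Ap))) (Dom.prod Dn An) Cn Cp :=
  Hom.curry (fun u x => onUp x.1.2 fun p => run P (u, p.1) ((x.1.1, p.2), x.2))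
    (scott_onUp (by fun_prop) (by fun_prop))

noncomputable def impR (P : Pr (Dom.prod Γ T) Dp Dn An Ap) :
    Pr Γ Dp Dn (Dom.lift (Dom.prod T An)) Ap :=
  Hom.curry (fun u x => onUp x.2 fun p => run P (u, p.1) (x.1, p.2))
    (scott_onUp (by fun_prop) (by fun_prop))

noncomputable def impL (M : Hom Γ T) (P : Pr Γ (Dom.prod Dp Ap) (Dom.prod Dn An) Cn Cp) :
    Pr Γ (Dom.prod Dp Ap) (Dom.prod Dn (Dom.lift (Dom.prod T An))) Cn Cp :=
  Hom.curry (fun u x =>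
    let v := ap M u
    let y := run P u x
    strictOn v ((y.1.1, (((v, y.1.2) : T × An) : WithBot (T × An))), y.2)) (by fun_prop)

/-- Conversion of the provided channel: `x ↦ π (P (x with c⁻ mapped by i))`. -/
noncomputable def mapR {An' Ap' : Dom} (i : Hom An' An) (o : Hom Ap Ap') (P : Pr Γ Dp Dn An Ap) :
    Pr Γ Dp Dn An' Ap' :=
  Hom.curry (fun u x => let y := run P u (x.1, ap i x.2); (y.1, ap o y.2)) (by fun_prop)

/-- Conversion of a used channel. -/
noncomputable def mapL {An' Ap' : Dom} (i : Hom Ap' Ap) (o : Hom An An')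
    (P : Pr Γ (Dom.prod Dp Ap) (Dom.prod Dn An) Cn Cp) :
    Pr Γ (Dom.prod Dp Ap') (Dom.prod Dn An') Cn Cp :=
  Hom.curry (fun u x =>
    let y := run P u ((x.1.1, ap i x.1.2), x.2)
    ((y.1.1, ap o y.1.2), y.2)) (by fun_prop)

/-- `λx. M` denotes the strict function `v ↦ ⟦M⟧[u | x ↦ v]`. -/
noncomputable def lam {S : Dom} (M : Hom (Dom.prod Γ T) S) : Hom Γ (Dom.sfn T S) where
  toFun u := ⟨⟨fun v => strictOn v (ap M (u, v)), by fun_prop⟩, strictOn_of_eq rfl⟩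
  cont := SHom.scott_hom fun v => by
    show ScottContinuous fun u => strictOn v (ap M (u, v))
    fun_prop

noncomputable def app {S : Dom} (M : Hom Γ (Dom.sfn T S)) (N : Hom Γ T) : Hom Γ S where
  toFun u := M u (N u)
  cont := SHom.scott_app' M.cont N.cont

noncomputable def quo (P : Pr Γ Dp Dn An Ap) :
    Hom Γ (Dom.lift (Dom.fn (Dom.prod Dp An) (Dom.prod Dn Ap))) where
  toFun u := (P u : WithBot (Hom (Dom.prod Dp An) (Dom.prod Dn Ap)))
  cont := P.cont.comp scott_coe

noncomputable def unquo (M : Hom Γ (Dom.lift (Dom.fn (Dom.prod Dp An) (Dom.prod Dn Ap)))) :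
    Pr Γ Dp Dn An Ap where
  toFun u := down (M u)
  cont := M.cont.comp scott_down

end Sem

/-! ### The denotations of terms and processes -/

mutual

/-- `⟦Ψ ⊢ M : τ⟧` -/
noncomputable def Tm.den : ∀ {Ψ : FCtx} {τ : FType}, Tm Ψ τ → Hom Ψ.dom τ.den
  | _, _, .var v => v.den
  | _, _, .lam M => Sem.lam M.den
  | _, _, .app M N => Sem.app M.den N.den
  | _, _, .fix M => Hom.dagger M.den
  | _, _, .quo (as := as) (As := As) _ P =>
    Sem.quo (Sem.dimap (CCtx.mkNames .pos as As) (CCtx.unNames .neg as As) P.den)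

/-- `⟦Ψ; Δ ⊢ P :: c : C⟧`, a continuous function `⟦Ψ⟧ → [⟦Δ⟧^+ × ⟦c : C⟧^- → ⟦Δ⟧^- × ⟦c : C⟧^+]` -/
noncomputable def Proc.den : ∀ {Ψ : FCtx} {Δ : CCtx} {c : Chan} {C : CType},
    Proc Ψ Δ c C → Hom Ψ.dom (seqDom Δ C)
  | _, _, _, _, .fwd (A := A) a _ _ => Sem.close1 a A Sem.fwd
  | _, _, _, _, .cut (Δ₁ := Δ₁) (Δ₂ := Δ₂) (A := A) a _ _ _ P Q =>
    Sem.dimap (CCtx.unUnion Δ₁ Δ₂ .pos) (CCtx.mkUnion Δ₁ Δ₂ .neg)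
      (Sem.cut P.den (Sem.open1 a A Q.den))
  | _, _, _, _, .close _ => Sem.close
  | _, _, _, _, .wait a _ _ P => Sem.close1 a ⟨.pos, .one⟩ (Sem.wait P.den)
  | _, _, _, _, .downR P => Sem.downR P.den
  | _, _, _, _, .downL (A := A) a _ P =>
    Sem.close1 a ⟨.pos, .down A⟩ (Sem.downL (Sem.open1 a ⟨.neg, A⟩ P.den))
  | _, _, _, _, .upR P => Sem.upR P.den
  | _, _, _, _, .upL (A := A) a _ P =>
    Sem.close1 a ⟨.neg, .up A⟩ (Sem.upL (Sem.open1 a ⟨.pos, A⟩ P.den))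
  | _, _, _, _, .plusR k P => Sem.plusR k P.den
  | _, _, _, _, .plusL (L := L) (A := A) a _ _ _ _ P =>
    Sem.close1 a ⟨.pos, .plus L A⟩ (Sem.plusL fun l => Sem.open1 a ⟨.pos, A l⟩ (P l).den)
  | _, _, _, _, .ampR _ _ P => Sem.ampR fun l => (P l).den
  | _, _, _, _, .ampL (L := L) (A := A) a _ k P =>
    Sem.close1 a ⟨.neg, .amp L A⟩ (Sem.ampL k (Sem.open1 a ⟨.neg, A k⟩ P.den))
  | _, _, _, _, .tensorR (B := B) b _ _ P => Sem.close1 b ⟨.pos, B⟩ (Sem.tensorR P.den)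
  | _, _, _, _, .tensorL (A := A) (B := B) a b _ _ _ P =>
    Sem.close1 a ⟨.pos, .tensor B A⟩ (Sem.tensorL (Sem.open2 a ⟨.pos, A⟩ b ⟨.pos, B⟩ P.den))
  | _, _, _, _, .lollyR (B := B) b _ P => Sem.lollyR (Sem.open1 b ⟨.pos, B⟩ P.den)
  | _, _, _, _, .lollyL (B := B) (A := A) a b _ _ _ _ P =>
    Sem.close2 b ⟨.pos, B⟩ a ⟨.neg, .lolly B A⟩ (Sem.lollyL (Sem.open1 a ⟨.neg, A⟩ P.den))
  | _, _, _, _, .andR M P => Sem.andR M.den P.den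
  | _, _, _, _, .andL (τ := τ) (A := A) a _ P =>
    Sem.close1 a ⟨.pos, .and τ A⟩ (Sem.andL (Sem.open1 a ⟨.pos, A⟩ P.den))
  | _, _, _, _, .impR P => Sem.impR P.den
  | _, _, _, _, .impL (τ := τ) (A := A) a _ M P =>
    Sem.close1 a ⟨.neg, .imp τ A⟩ (Sem.impL M.den (Sem.open1 a ⟨.neg, A⟩ P.den))
  | _, _, _, _, .rhoR (A := A) P => Sem.mapR (A.unfoldHom .neg) (A.foldHom .pos) P.den
  | _, _, _, _, .rhoL (p := p) (A := A) a _ P =>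
    Sem.close1 a ⟨p, .rho A⟩
      (Sem.mapL (A.unfoldHom .pos) (A.foldHom .neg) (Sem.open1 a ⟨p, A.unroll⟩ P.den))
  | _, _, _, _, .unquo (as := as) (As := As) M =>
    Sem.dimap (CCtx.unNames .pos as As) (CCtx.mkNames .neg as As) (Sem.unquo M.den)

end

/-- Denotational equivalence of processes of the same type. -/
noncomputable def Proc.Equiv {Ψ : FCtx} {Δ : CCtx} {c : Chan} {C : CType} (P Q : Proc Ψ Δ c C) : Prop :=
  P.den = Q.den

end SILL

namespace SILL

-- Fixed points, the trace, and transport between equal domains.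

namespace Hom

variable {D A B X : Dom}

/-- Kleene's argument: `f` preserves the supremum of the directed chain `fⁿ(⊥)`, and applying `f` to
this chain only drops its term `⊥`, which does not affect the supremum. -/
theorem map_fix (f : Hom D D) : f (fix D f) = fix D f := by
  have hdir : DirectedOn (· ≤ ·) (Set.range fun n => iter D n f) :=
    (show Monotone fun n => iter D n f from fun m n h => iter_mono D h f).directed_le.directedOn_range
  -- The operator `fix D` is a supremum of the operators `iter D n` in a function domain. Directed
  -- suprema there are computed pointwise, so evaluation at `f` gives the supremum of the iterates.
  have hlub : IsLUB (Set.range fun n => iter D n f) (fix D f) := by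
    have h := (isLUB_iff (iter_mono D).directed_le.directedOn_range).1
      (isLUB_sup (Set.range (iter D)) (iter_mono D).directed_le.directedOn_range) f
    rwa [← Set.range_comp] at h
  have himg := f.cont (Set.range_nonempty _) hdir hlub
  -- It suffices that `fix D f` is also a least upper bound of the shifted chain `fⁿ⁺¹(⊥)`, the
  -- image of the chain under `f`.
  refine himg.unique ⟨?_, fun y hy => hlub.2 ?_⟩
  · rintro _ ⟨_, ⟨n, rfl⟩, rfl⟩
    exact hlub.1 ⟨n + 1, rfl⟩
  · rintro _ ⟨n, rfl⟩
    cases n with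
    -- The only iterate outside the shifted chain is `⊥`, which lies below any `y`.
    | zero => exact bot_le
    | succ n => exact hy ⟨_, ⟨n, rfl⟩, rfl⟩

/-- The trace is computed at a feedback value `x` that solves the feedback equation. -/
theorem exists_trace_apply (f : Hom (Dom.prod A X) (Dom.prod B X)) (a : A) :
    ∃ x : X, (f (a, x)).2 = x ∧ trace f a = (f (a, x)).1 :=
  -- The feedback value is the one in the definition of `trace`: the least fixed point of `x ↦ (f
  -- (a, x)).2`. The second conjunct is therefore the definition itself, and the first is the
  -- fixed-point equation.
  ⟨_, map_fix (D := X) ⟨fun x => (f (a, x)).2,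
    (((ScottContinuous.fun_const a).prodMk ScottContinuous.fun_id).comp f.cont).comp
      ScottContinuous.snd⟩, rfl⟩

/-- The equality `ho` of the indices can be eliminated by substitution, unlike the equations between
the compound expressions `optDom o q` and `optDom o' q`. Afterwards both transports are along proofs
of a reflexive equation and reduce to the identity, whatever those proofs were. -/
theorem cast_optDom_cast {q : Pol} {o o' : Option CType} (h : optDom o q = optDom o' q)
    (h' : optDom o' q = optDom o q) (ho : o = o') (x : optDom o q) :
    cast h' (cast h x) = x := by
  subst ho
  rfl

end Hom

-- Packing and unpacking the interpretations of contexts.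

namespace CCtx

/-- The case distinction in `restrict` chooses between component maps, not between values. The
branch is therefore selected by an equation between maps, which is then evaluated at `x`; the two
lemmas on `mkExt` below follow the same pattern. -/
theorem restrict_apply_of_eq {Δ Δ' : CCtx} {c : Chan} (h : Δ c = Δ' c) (q : Pol) (x : Δ.dom q) :
    restrict Δ Δ' q x c = Hom.cast (congrArg (fun o => optDom o q) h) (x c) :=
  congrArg (fun f : Hom (Δ.dom q) (optDom (Δ' c) q) => f x) (dif_pos h)

theorem mkExt_apply_self (Δ : CCtx) (q : Pol) (a : Chan) (A : CType)
    (x : Dom.prod (Δ.dom q) (A.dom q)) :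
    mkExt Δ q a A x a =
      Hom.cast (congrArg (fun o => optDom o q) (ext_self Δ a A).symm) x.2 :=
  congrArg (fun f : Hom (Dom.prod (Δ.dom q) (A.dom q)) (optDom (Δ.ext a A a) q) => f x)
    (dif_pos rfl)

theorem mkExt_apply_of_ne (Δ : CCtx) (q : Pol) {a c : Chan} (A : CType) (h : c ≠ a)
    (x : Dom.prod (Δ.dom q) (A.dom q)) :
    mkExt Δ q a A x c =
      Hom.cast (congrArg (fun o => optDom o q) (show Δ c = Δ.ext a A c from (if_neg h).symm))
        (x.1 c) :=
  congrArg (fun f : Hom (Dom.prod (Δ.dom q) (A.dom q)) (optDom (Δ.ext a A c) q) => f x)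
    (dif_neg h)

/-- Away from `a`, packing and unpacking transport a component along an equality of types and back.
At `a`, packing stores `x.2` and discards `x.1 a`. The freshness of `a` makes this harmless: `x.1 a`
lives in a one-point domain and can be recovered from nothing. -/
theorem unext_mkExt (Δ : CCtx) (q : Pol) (a : Chan) (A : CType) (ha : Δ a = none)
    (x : Dom.prod (Δ.dom q) (A.dom q)) : unext Δ q a A (mkExt Δ q a A x) = x := by
  refine Prod.ext (funext fun c => ?_) ?_
  · show restrict (Δ.ext a A) Δ q (mkExt Δ q a A x) c = x.1 c
    by_cases hc : c = a
    · subst hc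
      -- At the name `a` itself the factor of `Δ` is that of an absent channel, so the two
      -- components agree without any computation of `restrict`.
      have : Subsingleton (optDom (Δ c) q) := by
        rw [ha]
        exact inferInstanceAs (Subsingleton PUnit)
      exact Subsingleton.elim _ _
    · have h : Δ.ext a A c = Δ c := if_neg hc
      rw [restrict_apply_of_eq h, mkExt_apply_of_ne _ _ _ hc]
      -- The component went from the factor of `Δ` to that of the extended context and came back.
      exact Hom.cast_optDom_cast _ _ h.symm _
  · show Hom.cast _ (mkExt Δ q a A x a) = _
    rw [mkExt_apply_self]
    -- The domain of `A` has to be read as `optDom (some A) q` for the transports to have the form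
    -- treated by the lemma.
    exact Hom.cast_optDom_cast (o := some A) _ _ (ext_self Δ a A).symm _

/-- Every name satisfies the test in `restrict` by reflexivity, and the transport along a reflexive
equation is the identity. This also covers the restriction from the union of the empty context with
`Δ`, which is definitionally `Δ`. -/
theorem restrict_self (Δ : CCtx) (q : Pol) (x : Δ.dom q) : restrict Δ Δ q x = x :=
  funext fun _ => restrict_apply_of_eq rfl q x

end CCtx

namespace Sem

variable {Γ Dp Dn Dp' Dn' Cn Cp : Dom}

/-- The composite sends the positive input and the negative output each through `mkExt` followed by
`unext`, and both round trips are the identity when `a` is fresh. This is how the unpacking in the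
clause for cut meets the packing in the clause for `wait`. -/
theorem open1_close1 {Δ : CCtx} (a : Chan) (A : CType) (ha : Δ a = none)
    (P : Pr Γ (Dom.prod (Δ.dom .pos) (A.dom .pos)) (Dom.prod (Δ.dom .neg) (A.dom .neg)) Cn Cp) :
    open1 a A (close1 a A P) = P := by
  refine Hom.ext fun u => Hom.ext fun x => ?_
  -- The output over the context passes through both round trips, the output on the provided channel
  -- depends on the input one only.
  refine Prod.ext ?_ ?_
  · show CCtx.unext Δ .neg a A (CCtx.mkExt Δ .neg a A
      (P u (CCtx.unext Δ .pos a A (CCtx.mkExt Δ .pos a A x.1), x.2)).1) = _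
    rw [CCtx.unext_mkExt _ _ _ _ ha, CCtx.unext_mkExt _ _ _ _ ha]
  · show (P u (CCtx.unext Δ .pos a A (CCtx.mkExt Δ .pos a A x.1), x.2)).2 = _
    rw [CCtx.unext_mkExt _ _ _ _ ha]

/-- The signal of `close` on `a⁺` is constant, so the feedback equation determines `a⁺` outright and
`wait` is evaluated where its strictness test succeeds. The primed domains belong to `close`, which
outputs `⊥` over its own context; the unprimed ones belong to `P`. -/
theorem cut_close_wait (P : Pr Γ Dp Dn Cn Cp) (u : Γ) (x : Dom.prod (Dom.prod Dp' Dp) Cn) :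
    cut (Dn := Dn') close (wait P) u x = ((⊥, (P u (x.1.2, x.2)).1), (P u (x.1.2, x.2)).2) := by
  obtain ⟨z, hz, h⟩ := Hom.exists_trace_apply
    (par ((close : Pr Γ Dp' Dn' Dom.unit (Dom.lift Dom.unit)) u) (wait P u)) x
  -- Here `z = (a⁻, a⁺)`. The second component of the feedback equation says that `a⁺` is the output
  -- of `close`, a constant that does not involve `z`.
  have h2 : z.2 = ((⟨⟩ : PUnit) : WithBot PUnit) := (congrArg Prod.snd hz).symm
  have hw : wait P u ((x.1.2, z.2), x.2) =
      (((P u (x.1.2, x.2)).1, ⊥), (P u (x.1.2, x.2)).2) :=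
    strictOn_of_ne (by rw [h2]; exact WithBot.coe_ne_bot)
  refine h.trans ?_
  show ((⊥, (wait P u ((x.1.2, z.2), x.2)).1.1), (wait P u ((x.1.2, z.2), x.2)).2) = _
  rw [hw]

end Sem

end SILL

/-- The composite has a type over the union of the empty context with `Δ`. At each name this union
computes to the entry of `Δ`, so the two processes have definitionally the same type and can be
compared without transport. For the same reason the side conditions on the empty context hold by
`rfl`. -/
theorem mainTheorem8 (Ψ : SILL.FCtx) (Δ : SILL.CCtx) (c : SILL.Chan) (C : SILL.CType)
    (P : SILL.Proc Ψ Δ c C) (a : SILL.Chan) (ha : Δ a = none) (hac : a ≠ c) :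
    SILL.Proc.Equiv P
      (SILL.Proc.cut (Δ₁ := SILL.CCtx.empty) (Δ₂ := Δ) a (fun _ => Or.inl rfl) ha rfl
        (SILL.Proc.close a) (SILL.Proc.wait a ha hac P)) := by
  unfold SILL.Proc.Equiv
  symm
  simp only [SILL.Proc.den]
  refine SILL.Hom.ext fun u => SILL.Hom.ext fun x => ?_
  have hopen := SILL.Sem.open1_close1 a ⟨.pos, .one⟩ ha (SILL.Sem.wait P.den)
  refine (congrArg (fun Q => SILL.Sem.dimap (SILL.CCtx.unUnion SILL.CCtx.empty Δ .pos)
    (SILL.CCtx.mkUnion SILL.CCtx.empty Δ .neg) (SILL.Sem.cut SILL.Sem.close Q) u x) hopen).trans ?_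
  have hin : SILL.CCtx.restrict (SILL.CCtx.empty.union Δ) Δ .pos x.1 = x.1 :=
    SILL.CCtx.restrict_self Δ .pos x.1
  have hcut := SILL.Sem.cut_close_wait (Dn' := SILL.CCtx.empty.dom .neg) P.den u
    (SILL.CCtx.unUnion SILL.CCtx.empty Δ .pos x.1, x.2)
  refine (congrArg (fun y => (SILL.CCtx.mkUnion SILL.CCtx.empty Δ .neg y.1, y.2)) hcut).trans ?_
  -- Merging the outputs takes the second component at every name, since no name occurs in the empty
  -- context. The `⊥` produced by `close` thereby disappears.
  show ((P.den u (SILL.CCtx.restrict (SILL.CCtx.empty.union Δ) Δ .pos x.1, x.2)).1,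
    (P.den u (SILL.CCtx.restrict (SILL.CCtx.empty.union Δ) Δ .pos x.1, x.2)).2) = _
  rw [hin]
  -- What is left is the eta rule for pairs, on the input and on the output.
  rfl
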